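/- **Setting.** Let $\mathcal N$ be a smooth $m$-dimensional manifold (without boundary; all fields smooth) and let $\{\mathcal N,\gamma,\ell,\ell^{(2)}\}$ be metric hypersurface data: $\gamma$ is a symmetric two-covariant tensor field, $\ell$ a one-form and $\ell^{(2)}$ a scalar such that at every $p$ the symmetric bilinear form $$\mathcal A|_p((W,a),(Z,b))=\gamma(W,Z)+a\,\ell(Z)+b\,\ell(W)+ab\,\ell^{(2)}$$ on $T_p\mathcal N\oplus\mathbb R$ is non-degenerate. Its inverse $\mathcal A^\sharp$ (the symmetric two-contravariant tensor with $\mathcal A^\sharp(\cdot,\mathcal A(V,\cdot))=V$) defines a symmetric contravariant tensor $P^{ab}$, a vector field $n^a$ and a scalar $n^{(2)}$ by $$\mathcal A^\sharp((\alpha,a),(\beta,b))=P(\alpha,\beta)+a\,\beta(n)+b\,\alpha(n)+ab\,n^{(2)}.$$ Put $$F=\tfrac12 d\ell,\qquad \hat s=i_nF\ (\hat s_b=n^aF_{ab}),\qquad U=\tfrac12\mathcal L_n\gamma+\tfrac12\left(\ell\otimes dn^{(2)}+dn^{(2)}\otimes\ell\right).$$ There exists a torsion-free connection $\mathring\nabla$,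 the (unique) metric hypersurface connection, with $$(\mathring\nabla_X\gamma)(Z,W)=-U(X,Z)\ell(W)-U(X,W)\ell(Z),\qquad (\mathring\nabla_X\ell)(Z)+(\mathring\nabla_Z\ell)(X)=-2\ell^{(2)}U(X,Z)$$ for all vector fields $X,Z,W$. Its curvature is $R(X,Y)Z=\mathring\nabla_X\mathring\nabla_YZ-\mathring\nabla_Y\mathring\nabla_XZ-\mathring\nabla_{[X,Y]}Z$, with components $(R(X,Y)Z)^d=\mathring R^d{}_{acb}Z^aX^cY^b$. Square brackets denote antisymmetrization, $t_{[cb]}=\frac12(t_{cb}-t_{bc})$, and $(n^{(2)})^2$ is the square of $n^{(2)}$. **Proposition.** The curvature of $\mathring\nabla$ satisfies $$\ell_d\mathring R^d{}_{acb}=\mathring\nabla_aF_{cb}+\mathring\nabla_c(\ell^{(2)}U_{ba})-\mathring\nabla_b(\ell^{(2)}U_{ca}),\tag{first}$$ $$\begin{aligned}\ell_d\mathring R^d{}_{acb}n^c={}&\mathring\nabla_a\hat s_b+\mathcal L_n(\ell^{(2)}U)_{ba}+(F_{bc}-\ell^{(2)}U_{bc})P^{cf}(U_{af}-n^{(2)}F_{af})\\&+n^{(2)}\ell^{(2)}\mathring\nabla_b\hat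 s_a-\tfrac12\mathring\nabla_b\mathring\nabla_a(n^{(2)}\ell^{(2)})+\tfrac12\mathring\nabla_b(n^{(2)}\ell^{(2)})\,\hat s_a\\&+(n^{(2)}\ell^{(2)}-1)\Big((\hat s_b-\tfrac12n^{(2)}\mathring\nabla_b\ell^{(2)})(\hat s_a-n^{(2)}\mathring\nabla_a\ell^{(2)})-\tfrac12\mathring\nabla_b(n^{(2)}\mathring\nabla_a\ell^{(2)})\Big),\end{aligned}\tag{second}$$ $$\begin{aligned}\mathring R^d{}_{acb}n^a={}&n^d\Big(2\mathring\nabla_{[c}\hat s_{b]}+\mathring\nabla_{[c}\ell^{(2)}\mathring\nabla_{b]}n^{(2)}+2P^{af}F_{a[c}U_{b]f}\Big)\\&+P^{df}\Big[2\mathring\nabla_{[c}U_{b]f}+n^{(2)}\mathring\nabla_fF_{cb}+2U_{f[c}\big(\hat s_{b]}-n^{(2)}\mathring\nabla_{b]}\ell^{(2)}\big)\\&\qquad+F_{f[c}\big(2n^{(2)}\hat s_{b]}-\mathring\nabla_{b]}n^{(2)}-(n^{(2)})^2\mathring\nabla_{b]}\ell^{(2)}\big)\Big],\end{aligned}\tag{third}$$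 $$\begin{aligned}\ell_d\mathring R^d{}_{acb}n^a={}&(1-\ell^{(2)}n^{(2)})\Big(2\mathring\nabla_{[c}\hat s_{b]}+2P^{af}F_{a[c}U_{b]f}+\mathring\nabla_{[c}\ell^{(2)}\mathring\nabla_{b]}n^{(2)}\Big)\\&+\ell^{(2)}\hat s_{[c}\big(\mathring\nabla_{b]}n^{(2)}+(n^{(2)})^2\mathring\nabla_{b]}\ell^{(2)}\big),\end{aligned}\tag{fourth}$$ $$\begin{aligned}\ell_d\mathring R^d{}_{acb}n^an^c={}&(1-\ell^{(2)}n^{(2)})\Big(\mathcal L_n\hat s_b-\hat s_aP^{af}(U_{bf}+n^{(2)}F_{bf})+\tfrac12P^{af}F_{ba}\big(\mathring\nabla_fn^{(2)}+(n^{(2)})^2\mathring\nabla_f\ell^{(2)}\big)\Big)\\&+\tfrac12n(\ell^{(2)})\Big[(1-\ell^{(2)}n^{(2)})\mathring\nabla_bn^{(2)}-\ell^{(2)}(n^{(2)})^2\hat s_b\Big]\\&-\tfrac12n(n^{(2)})\Big[(1-n^{(2)}\ell^{(2)})\mathring\nabla_b\ell^{(2)}+\ell^{(2)}\hat s_b\Big].\end{aligned}\tag{fifth}$$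 -/

import Mathlib

open scoped Manifold ContDiff Bundle
open VectorField

noncomputable section

namespace HypersurfaceData

/-! Manifolds are modelled on a finite-dimensional real vector space `E`, without boundary.
The tangent space at `x` is `TangentSpace 𝓘(ℝ, E) x`. -/

section TensorFields

variable (E : Type*) [NormedAddCommGroup E] [NormedSpace ℝ E]
  (M : Type*) [TopologicalSpace M] [ChartedSpace E M]

/-- Vector fields (not necessarily smooth). -/
abbrev VField : Type _ := Π x : M, TangentSpace 𝓘(ℝ, E) x

/-- One-forms (not necessarily smooth). -/
abbrev OneForm : Type _ := Π x : M, TangentSpace 𝓘(ℝ, E) x →L[ℝ] ℝ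

/-- Two-covariant tensor fields (not necessarily smooth). -/
abbrev CovTensor2 : Type _ :=
  Π x : M, TangentSpace 𝓘(ℝ, E) x →L[ℝ] TangentSpace 𝓘(ℝ, E) x →L[ℝ] ℝ

end TensorFields

variable {E : Type*} [NormedAddCommGroup E] [NormedSpace ℝ E]
  {M : Type*} [TopologicalSpace M] [ChartedSpace E M]

/-- Smoothness of a vector field. -/
def SmoothVField [IsManifold 𝓘(ℝ, E) ∞ M] (X : VField E M) : Prop :=
  ContMDiff 𝓘(ℝ, E) (𝓘(ℝ, E).prod 𝓘(ℝ, E)) ∞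
    (fun x ↦ Bundle.TotalSpace.mk' E x (X x))

/-- Smoothness of a one-form. -/
def SmoothOneForm [IsManifold 𝓘(ℝ, E) ∞ M] (θ : OneForm E M) : Prop :=
  ContMDiff 𝓘(ℝ, E) (𝓘(ℝ, E).prod 𝓘(ℝ, E →L[ℝ] ℝ)) ∞
    (fun x ↦ Bundle.TotalSpace.mk' (E →L[ℝ] ℝ) x (θ x))

/-- Smoothness of a two-covariant tensor field. -/
def SmoothCovTensor2 [IsManifold 𝓘(ℝ, E) ∞ M] (T : CovTensor2 E M) : Prop :=
  ContMDiff 𝓘(ℝ, E) (𝓘(ℝ, E).prod 𝓘(ℝ, E →L[ℝ] E →L[ℝ] ℝ)) ∞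
    (fun x ↦ Bundle.TotalSpace.mk' (E →L[ℝ] E →L[ℝ] ℝ) x (T x))

/-! ### Lie derivative and exterior derivative, evaluated on vector fields -/

/-- The differential of a function, as a one-form. -/
def diff (f : M → ℝ) : OneForm E M := fun x ↦ mvfderiv 𝓘(ℝ, E) f x

/-- `(£_W θ)(X) = W(θ(X)) - θ([W, X])`. -/
def lieOneForm (W : VField E M) (θ : OneForm E M) (X : VField E M) : M → ℝ := fun x ↦
  mvfderiv 𝓘(ℝ, E) (fun y ↦ θ y (X y)) x (W x) - θ x (mlieBracket 𝓘(ℝ, E) W X x)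

/-- `(£_W T)(X, Y) = W(T(X, Y)) - T([W, X], Y) - T(X, [W, Y])`. -/
def lieCovTensor2 (W : VField E M) (T : CovTensor2 E M) (X Y : VField E M) : M → ℝ := fun x ↦
  mvfderiv 𝓘(ℝ, E) (fun y ↦ T y (X y) (Y y)) x (W x)
    - T x (mlieBracket 𝓘(ℝ, E) W X x) (Y x) - T x (X x) (mlieBracket 𝓘(ℝ, E) W Y x)

/-- `(dθ)(X, Y) = X(θ(Y)) - Y(θ(X)) - θ([X, Y])`. -/
def extDerivOneForm (θ : OneForm E M) (X Y : VField E M) : M → ℝ := fun x ↦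
  mvfderiv 𝓘(ℝ, E) (fun y ↦ θ y (Y y)) x (X x) - mvfderiv 𝓘(ℝ, E) (fun y ↦ θ y (X y)) x (Y x)
    - θ x (mlieBracket 𝓘(ℝ, E) X Y x)

/-- The one-form `T(·, w)` at `x`. -/
def leftSlot (T : CovTensor2 E M) (x : M) (w : TangentSpace 𝓘(ℝ, E) x) :
    TangentSpace 𝓘(ℝ, E) x →L[ℝ] ℝ where
  toFun v := T x v w
  map_add' v v' := by simp
  map_smul' c v := by simp
  cont := by fun_prop

section Tensoriality

variable [IsManifold 𝓘(ℝ, E) ∞ M]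

theorem SmoothOneForm.mdifferentiableAt_apply {θ : OneForm E M} (hθ : SmoothOneForm θ) {x : M}
    {X : VField E M} (hX : MDiffAt (T% X) x) :
    MDifferentiableAt 𝓘(ℝ, E) 𝓘(ℝ, ℝ) (fun y ↦ θ y (X y)) x := by
  have hθ' : MDifferentiableAt 𝓘(ℝ, E) (𝓘(ℝ, E).prod 𝓘(ℝ, E →L[ℝ] ℝ))
      (fun y ↦ Bundle.TotalSpace.mk' (E →L[ℝ] ℝ) y (θ y)) x :=
    (ContMDiff.mdifferentiable hθ (by simp)) x
  have : MDifferentiableAt 𝓘(ℝ, E) (𝓘(ℝ, E).prod 𝓘(ℝ, ℝ))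
      (fun y ↦ Bundle.TotalSpace.mk' ℝ (E := Bundle.Trivial M ℝ) y (θ y (X y))) x :=
    MDifferentiableAt.clm_bundle_apply (F₁ := E) hθ' hX
  exact (mdifferentiableAt_totalSpace _ _).1 this |>.2

theorem SmoothCovTensor2.mdifferentiableAt_apply {T : CovTensor2 E M} (hT : SmoothCovTensor2 T)
    {x : M} {X Y : VField E M} (hX : MDiffAt (T% X) x) (hY : MDiffAt (T% Y) x) :
    MDifferentiableAt 𝓘(ℝ, E) 𝓘(ℝ, ℝ) (fun y ↦ T y (X y) (Y y)) x := by
  have hT' : MDifferentiableAt 𝓘(ℝ, E) (𝓘(ℝ, E).prod 𝓘(ℝ, E →L[ℝ] E →L[ℝ] ℝ))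
      (fun y ↦ Bundle.TotalSpace.mk' (E →L[ℝ] E →L[ℝ] ℝ) y (T y)) x :=
    (ContMDiff.mdifferentiable hT (by simp)) x
  have : MDifferentiableAt 𝓘(ℝ, E) (𝓘(ℝ, E).prod 𝓘(ℝ, ℝ))
      (fun y ↦ Bundle.TotalSpace.mk' ℝ (E := Bundle.Trivial M ℝ) y (T y (X y) (Y y))) x :=
    MDifferentiableAt.clm_bundle_apply₂ (F₁ := E) (F₂ := E) hT' hX hY
  exact (mdifferentiableAt_totalSpace _ _).1 this |>.2

variable [FiniteDimensional ℝ E]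

theorem tensorial_extDeriv_left {θ : OneForm E M} (hθ : SmoothOneForm θ) (x : M)
    (Y : VField E M) :
    TensorialAt 𝓘(ℝ, E) E (fun X : VField E M ↦ extDerivOneForm θ X Y x) x := by
  constructor
  · intro f X hf hX
    have h := hθ.mdifferentiableAt_apply hX
    have e : (fun y ↦ θ y ((f • X) y)) = fun y ↦ f y * θ y (X y) := by ext y; simp
    simp only [extDerivOneForm, e, mvfderiv_fun_mul hf h, mlieBracket_smul_left hf hX]
    simp
    ring
  · intro X X' hX hX'
    have h := hθ.mdifferentiableAt_apply hX
    have h' := hθ.mdifferentiableAt_apply hX'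
    have e : (fun y ↦ θ y ((X + X') y)) = fun y ↦ θ y (X y) + θ y (X' y) := by ext y; simp
    simp only [extDerivOneForm, e, mvfderiv_fun_add h h', mlieBracket_add_left hX hX']
    simp
    ring

theorem tensorial_extDeriv_right {θ : OneForm E M} (hθ : SmoothOneForm θ) (x : M)
    (X : VField E M) :
    TensorialAt 𝓘(ℝ, E) E (fun Y : VField E M ↦ extDerivOneForm θ X Y x) x := by
  constructor
  · intro f Y hf hY
    have h := hθ.mdifferentiableAt_apply hY
    have e : (fun y ↦ θ y ((f • Y) y)) = fun y ↦ f y * θ y (Y y) := by ext y; simp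
    simp only [extDerivOneForm, e, mvfderiv_fun_mul hf h, mlieBracket_smul_right hf hY]
    simp
    ring
  · intro Y Y' hY hY'
    have h := hθ.mdifferentiableAt_apply hY
    have h' := hθ.mdifferentiableAt_apply hY'
    have e : (fun y ↦ θ y ((Y + Y') y)) = fun y ↦ θ y (Y y) + θ y (Y' y) := by ext y; simp
    simp only [extDerivOneForm, e, mvfderiv_fun_add h h', mlieBracket_add_right hY hY']
    simp
    ring

theorem tensorial_lie_left (W : VField E M) {T : CovTensor2 E M} (hT : SmoothCovTensor2 T) (x : M)
    (Y : VField E M) (hY : MDiffAt (T% Y) x) :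
    TensorialAt 𝓘(ℝ, E) E (fun X : VField E M ↦ lieCovTensor2 W T X Y x) x := by
  constructor
  · intro f X hf hX
    have h := hT.mdifferentiableAt_apply hX hY
    have e : (fun y ↦ T y ((f • X) y) (Y y)) = fun y ↦ f y * T y (X y) (Y y) := by ext y; simp
    simp only [lieCovTensor2, e, mvfderiv_fun_mul hf h, mlieBracket_smul_right hf hX]
    simp
    ring
  · intro X X' hX hX'
    have h := hT.mdifferentiableAt_apply hX hY
    have h' := hT.mdifferentiableAt_apply hX' hY
    have e : (fun y ↦ T y ((X + X') y) (Y y)) = fun y ↦ T y (X y) (Y y) + T y (X' y) (Y y) := by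
      ext y; simp
    simp only [lieCovTensor2, e, mvfderiv_fun_add h h', mlieBracket_add_right hX hX']
    simp
    ring

theorem tensorial_lie_right (W : VField E M) {T : CovTensor2 E M} (hT : SmoothCovTensor2 T) (x : M)
    (X : VField E M) (hX : MDiffAt (T% X) x) :
    TensorialAt 𝓘(ℝ, E) E (fun Y : VField E M ↦ lieCovTensor2 W T X Y x) x := by
  constructor
  · intro f Y hf hY
    have h := hT.mdifferentiableAt_apply hX hY
    have e : (fun y ↦ T y (X y) ((f • Y) y)) = fun y ↦ f y * T y (X y) (Y y) := by ext y; simp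
    simp only [lieCovTensor2, e, mvfderiv_fun_mul hf h, mlieBracket_smul_right hf hY]
    simp
    ring
  · intro Y Y' hY hY'
    have h := hT.mdifferentiableAt_apply hX hY
    have h' := hT.mdifferentiableAt_apply hX hY'
    have e : (fun y ↦ T y (X y) ((Y + Y') y)) = fun y ↦ T y (X y) (Y y) + T y (X y) (Y' y) := by
      ext y; simp
    simp only [lieCovTensor2, e, mvfderiv_fun_add h h', mlieBracket_add_right hY hY']
    simp
    ring

/-- The exterior derivative of a smooth one-form, as a tensor field. -/
def extDerivTensor (θ : OneForm E M) (hθ : SmoothOneForm θ) : CovTensor2 E M := fun x ↦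
  TensorialAt.mkHom₂ (fun X Y ↦ extDerivOneForm θ X Y x) x
    (fun Y _ ↦ tensorial_extDeriv_left hθ x Y) (fun X _ ↦ tensorial_extDeriv_right hθ x X)

/-- The Lie derivative of a smooth two-covariant tensor field, as a tensor field. -/
def lieTensor (W : VField E M) (T : CovTensor2 E M) (hT : SmoothCovTensor2 T) : CovTensor2 E M :=
  fun x ↦ TensorialAt.mkHom₂ (fun X Y ↦ lieCovTensor2 W T X Y x) x
    (fun Y hY ↦ tensorial_lie_left W hT x Y hY) (fun X hX ↦ tensorial_lie_right W hT x X hX)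

theorem extDerivTensor_apply {θ : OneForm E M} (hθ : SmoothOneForm θ) {x : M} {X Y : VField E M}
    (hX : MDiffAt (T% X) x) (hY : MDiffAt (T% Y) x) :
    extDerivTensor θ hθ x (X x) (Y x) = extDerivOneForm θ X Y x :=
  TensorialAt.mkHom₂_apply _ _ hX hY

theorem lieTensor_apply (W : VField E M) {T : CovTensor2 E M} (hT : SmoothCovTensor2 T) {x : M}
    {X Y : VField E M} (hX : MDiffAt (T% X) x) (hY : MDiffAt (T% Y) x) :
    lieTensor W T hT x (X x) (Y x) = lieCovTensor2 W T X Y x :=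
  TensorialAt.mkHom₂_apply _ _ hX hY

end Tensoriality

/-! ### Covariant derivatives and curvature -/

section Connection

/-- An affine connection: a covariant derivative on the tangent bundle. The value
`nabla Z x (X x)` is `(∇_X Z)(x)`. -/
abbrev AffineConnection (E : Type*) [NormedAddCommGroup E] [NormedSpace ℝ E]
    (M : Type*) [TopologicalSpace M] [ChartedSpace E M] [IsManifold 𝓘(ℝ, E) ∞ M] : Type _ :=
  CovariantDerivative 𝓘(ℝ, E) E (fun x : M ↦ TangentSpace 𝓘(ℝ, E) x)

variable [IsManifold 𝓘(ℝ, E) ∞ M]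

/-- The vector field `∇_X Z`. -/
def nablaVec (nabla : AffineConnection E M) (X Z : VField E M) : VField E M :=
  fun x ↦ nabla Z x (X x)

/-- `(∇_X θ)(Z) = X(θ(Z)) - θ(∇_X Z)`. -/
def nablaOneForm (nabla : AffineConnection E M) (θ : OneForm E M) (X Z : VField E M) : M → ℝ :=
  fun x ↦ mvfderiv 𝓘(ℝ, E) (fun y ↦ θ y (Z y)) x (X x) - θ x (nablaVec nabla X Z x)

/-- `(∇_X T)(Z, W) = X(T(Z, W)) - T(∇_X Z, W) - T(Z, ∇_X W)`. -/
def nablaCovTensor2 (nabla : AffineConnection E M) (T : CovTensor2 E M) (X Z W : VField E M) :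
    M → ℝ := fun x ↦
  mvfderiv 𝓘(ℝ, E) (fun y ↦ T y (Z y) (W y)) x (X x)
    - T x (nablaVec nabla X Z x) (W x) - T x (Z x) (nablaVec nabla X W x)

/-- The curvature operator `R(X, Y) Z = ∇_X ∇_Y Z - ∇_Y ∇_X Z - ∇_{[X, Y]} Z`; in index notation
`(R(X, Y) Z)^d = R^d_{acb} Z^a X^c Y^b`. -/
def curvature (nabla : AffineConnection E M) (X Y Z : VField E M) : VField E M := fun x ↦
  nablaVec nabla X (nablaVec nabla Y Z) x - nablaVec nabla Y (nablaVec nabla X Z) x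
    - nablaVec nabla (mlieBracket 𝓘(ℝ, E) X Y) Z x

end Connection

/-! ### Metric hypersurface data -/

/-- The symmetric bilinear form
`𝒜((V, a), (W, b)) = γ(V, W) + a ℓ(W) + b ℓ(V) + a b ℓ⁽²⁾` on `T_x M × ℝ`. -/
def ambientForm (γ : CovTensor2 E M) (ell : OneForm E M) (ell2 : M → ℝ) (x : M) :
    LinearMap.BilinForm ℝ (TangentSpace 𝓘(ℝ, E) x × ℝ) :=
  LinearMap.mk₂ ℝ
    (fun V W ↦ γ x V.1 W.1 + V.2 * ell x W.1 + W.2 * ell x V.1 + V.2 * W.2 * ell2 x)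
    (fun V V' W ↦ by simp; ring) (fun c V W ↦ by simp; ring)
    (fun V W W' ↦ by simp; ring) (fun c V W ↦ by simp; ring)

end HypersurfaceData

/-- Metric hypersurface data `(γ, ℓ, ℓ⁽²⁾)` on the manifold `M`. -/
structure MetricHypersurfaceData (E : Type*) [NormedAddCommGroup E] [NormedSpace ℝ E]
    (M : Type*) [TopologicalSpace M] [ChartedSpace E M] [IsManifold 𝓘(ℝ, E) ∞ M] where
  γ : HypersurfaceData.CovTensor2 E M
  ell : HypersurfaceData.OneForm E M
  ell2 : M → ℝ
  smooth_γ : HypersurfaceData.SmoothCovTensor2 γ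
  smooth_ell : HypersurfaceData.SmoothOneForm ell
  smooth_ell2 : ContMDiff 𝓘(ℝ, E) 𝓘(ℝ, ℝ) ∞ ell2
  symm_γ : ∀ (x : M) (v w : TangentSpace 𝓘(ℝ, E) x), γ x v w = γ x w v
  nondegenerate : ∀ x : M, (HypersurfaceData.ambientForm γ ell ell2 x).Nondegenerate

namespace MetricHypersurfaceData

open HypersurfaceData

variable {E : Type*} [NormedAddCommGroup E] [NormedSpace ℝ E] [FiniteDimensional ℝ E]
  {M : Type*} [TopologicalSpace M] [ChartedSpace E M] [IsManifold 𝓘(ℝ, E) ∞ M]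
  (D : MetricHypersurfaceData E M)

instance finiteDimensional_tangentSpace (x : M) :
    FiniteDimensional ℝ (TangentSpace 𝓘(ℝ, E) x) :=
  inferInstanceAs (FiniteDimensional ℝ E)

/-- The inverse of `V ↦ 𝒜(V, ·)`, from the dual of `T_x M × ℝ` to `T_x M × ℝ`. -/
def sharp (x : M) : Module.Dual ℝ (TangentSpace 𝓘(ℝ, E) x × ℝ) →ₗ[ℝ]
    TangentSpace 𝓘(ℝ, E) x × ℝ :=
  ((ambientForm D.γ D.ell D.ell2 x).toDual (D.nondegenerate x)).symm.toLinearMap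

/-- The contravariant tensor `𝒜^♯`, that is, `𝒜^♯(Φ, 𝒜(V, ·)) = Φ(V)`. -/
def ambientSharp (x : M) (Φ Ψ : Module.Dual ℝ (TangentSpace 𝓘(ℝ, E) x × ℝ)) : ℝ :=
  Φ (D.sharp x Ψ)

theorem ambientSharp_ambientForm (x : M) (Φ : Module.Dual ℝ (TangentSpace 𝓘(ℝ, E) x × ℝ))
    (V : TangentSpace 𝓘(ℝ, E) x × ℝ) :
    D.ambientSharp x Φ (ambientForm D.γ D.ell D.ell2 x V) = Φ V := by
  simp only [ambientSharp, sharp]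
  exact congrArg Φ (LinearEquiv.symm_apply_apply _ V)

/-- The covector `(α, a)` on `T_x M × ℝ`, that is, `(V, b) ↦ α(V) + a b`. -/
def pairDual (x : M) (α : TangentSpace 𝓘(ℝ, E) x →L[ℝ] ℝ) (a : ℝ) :
    Module.Dual ℝ (TangentSpace 𝓘(ℝ, E) x × ℝ) :=
  α.toLinearMap.coprod (a • LinearMap.id)

/-- The vector field `n`. -/
def n : VField E M := fun x ↦ (D.sharp x (pairDual x 0 1)).1

/-- The scalar `n⁽²⁾`. -/
def n2 : M → ℝ := fun x ↦ (D.sharp x (pairDual x 0 1)).2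

/-- The vector `P(α, ·)`, with components `P^{ab} α_a`. -/
def Pvec (x : M) (α : TangentSpace 𝓘(ℝ, E) x →L[ℝ] ℝ) : TangentSpace 𝓘(ℝ, E) x :=
  (D.sharp x (pairDual x α 0)).1

/-- The contravariant tensor `P(α, β) = P^{ab} α_a β_b`. -/
def P (x : M) (α β : TangentSpace 𝓘(ℝ, E) x →L[ℝ] ℝ) : ℝ := β (D.Pvec x α)

/-- The decomposition of `𝒜^♯` that defines `P`, `n` and `n⁽²⁾`. -/
theorem ambientSharp_pairDual (x : M) (α β : TangentSpace 𝓘(ℝ, E) x →L[ℝ] ℝ) (a b : ℝ) :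
    D.ambientSharp x (pairDual x α a) (pairDual x β b) =
      D.P x α β + a * β (D.n x) + b * α (D.n x) + a * b * D.n2 x := by
  have key : ∀ Φ Ψ, D.ambientSharp x Φ Ψ = D.ambientSharp x Ψ Φ := by
    intro Φ Ψ
    have h (Φ') (v) : ambientForm D.γ D.ell D.ell2 x (D.sharp x Φ') v = Φ' v :=
      LinearMap.BilinForm.apply_toDual_symm_apply Φ' v
    have hs (v w) : ambientForm D.γ D.ell D.ell2 x v w = ambientForm D.γ D.ell D.ell2 x w v := by
      simp only [ambientForm, LinearMap.mk₂_apply, D.symm_γ x v.1 w.1]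
      ring
    rw [ambientSharp, ambientSharp, ← h Φ, hs, h]
  have e : ∀ (θ : TangentSpace 𝓘(ℝ, E) x →L[ℝ] ℝ) (c : ℝ),
      pairDual x θ c = pairDual x θ 0 + c • pairDual x 0 1 := by
    intro θ c
    ext <;> simp [pairDual]
  have ev : ∀ (θ : TangentSpace 𝓘(ℝ, E) x →L[ℝ] ℝ) (c : ℝ) v, pairDual x θ c v = θ v.1 + c * v.2 := by
    intro θ c v
    simp [pairDual]
  have k1 := key (pairDual x α a) (pairDual x β b)
  rw [k1, ambientSharp, e α a, map_add, map_smul, ev]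
  have k2 := key (pairDual x 0 1) (pairDual x α 0)
  simp only [ambientSharp, ev] at k2
  simp only [P, Pvec, n, n2, Prod.fst_add, Prod.snd_add, Prod.smul_fst, Prod.smul_snd, map_add,
    map_smul, smul_eq_mul]
  simp at k2
  rw [k2]
  ring

/-- `F = (1/2) dℓ`. -/
def F : CovTensor2 E M := fun x ↦ (1 / 2 : ℝ) • extDerivTensor D.ell D.smooth_ell x

/-- `U = (1/2) £_n γ + ℓ ⊗_s dn⁽²⁾`. -/
def U : CovTensor2 E M := fun x ↦
  (1 / 2 : ℝ) • lieTensor D.n D.γ D.smooth_γ x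
    + (1 / 2 : ℝ) • ((D.ell x).smulRight (diff D.n2 x) + (diff D.n2 x).smulRight (D.ell x))

/-- `ŝ = i_n F`. -/
def s : OneForm E M := fun x ↦ D.F x (D.n x)

/-- The tensor `ℓ⁽²⁾ U`. -/
def ell2U : CovTensor2 E M := fun x ↦ D.ell2 x • D.U x

/-- The defining property of the metric hypersurface connection: a smooth torsion-free connection
with `(∇_X γ)(Z, W) = - U(X, Z) ℓ(W) - U(X, W) ℓ(Z)` and
`(∇_X ℓ)(Z) + (∇_Z ℓ)(X) = - 2 ℓ⁽²⁾ U(X, Z)`. -/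
structure IsMetricHypersurfaceConnection (nabla : AffineConnection E M) : Prop where
  smooth : CovariantDerivative.ContMDiffCovariantDerivative nabla ∞
  torsion_free : nabla.torsion = 0
  nabla_γ : ∀ (x : M) (X Z W : VField E M),
    MDiffAt (T% X) x → MDiffAt (T% Z) x → MDiffAt (T% W) x →
    nablaCovTensor2 nabla D.γ X Z W x =
      - D.U x (X x) (Z x) * D.ell x (W x) - D.U x (X x) (W x) * D.ell x (Z x)
  nabla_ell : ∀ (x : M) (X Z : VField E M), MDiffAt (T% X) x → MDiffAt (T% Z) x →
    nablaOneForm nabla D.ell X Z x + nablaOneForm nabla D.ell Z X x =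
      - 2 * D.ell2 x * D.U x (X x) (Z x)

end MetricHypersurfaceData

end

open HypersurfaceData

open scoped Topology

/-! The defining properties of the connection and vanishing torsion give the structure equations `∇ℓ
= F - ℓ⁽²⁾U` and `∇γ = -U⊗ℓ`, symmetrized in the slots of `γ` (`mvfderiv_ell`, `mvfderiv_γ`).
Commuting two derivatives on the scalars `ℓ(Z)` and `γ(Z, W)` then yields Ricci identities for `ℓ`
and `γ` (`ell_curvature_aux`, `γ_curvature`). With the closedness of `F`, the one for `ℓ` becomes
the first identity.

The other identities come from contraction with `n`. Since `𝒜^♯` inverts `𝒜`, one has `γ(n, ·) =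
-n⁽²⁾ℓ` and `ℓ(n) = 1 - n⁽²⁾ℓ⁽²⁾`; this determines `U(·, n)` (`U_n`) and, by differentiation, `∇n`
(`nablaVec_n`). Substituting both into the Ricci identity for `ℓ` gives the second, fourth and fifth
identities. For the third, `γ(P(α, ·), V) = α(V) - α(n)ℓ(V)`: the `γ`-part of `R(X, Y)n` comes from
the Ricci identity for `γ`, its `ℓ`-part is the fourth identity, and together they give every
`α(R(X, Y)n)`.

Existence is a Koszul argument: `(∇_X Z, -U(X, Z))` must be the vector that `𝒜` sends to the Koszul
expression of `γ` together with `X(ℓ(Z)) - F(X, Z)`. Nondegeneracy supplies a vector, and `koszul_n`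
shows that its scalar component is indeed `-U(X, Z)`. -/

namespace HypersurfaceData

variable {E : Type*} [NormedAddCommGroup E] [NormedSpace ℝ E]
  {M : Type*} [TopologicalSpace M] [ChartedSpace E M]

/-! ### Smoothness of evaluations, derivatives and brackets. -/

section Calculus

/-- A map into continuous linear maps on a finite-dimensional space is smooth if all its
evaluations are. -/
theorem contMDiffAt_clm_of_apply {E₁ E₂ : Type*} [NormedAddCommGroup E₁] [NormedSpace ℝ E₁]
    [FiniteDimensional ℝ E₁] [NormedAddCommGroup E₂] [NormedSpace ℝ E₂]
    {f : M → E₁ →L[ℝ] E₂} {x₀ : M} {k : WithTop ℕ∞}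
    (h : ∀ v, ContMDiffAt 𝓘(ℝ, E) 𝓘(ℝ, E₂) k (fun x ↦ f x v) x₀) :
    ContMDiffAt 𝓘(ℝ, E) 𝓘(ℝ, E₁ →L[ℝ] E₂) k f x₀ := by
  let d := Module.finrank ℝ E₁
  have hd : d = Module.finrank ℝ (Fin d → ℝ) := (Module.finrank_fin_fun ℝ).symm
  let e₁ := ContinuousLinearEquiv.ofFinrankEq hd
  -- `e₂` identifies a linear map with its values on a basis, so finitely many evaluations control
  -- `f`.
  let e₂ := (e₁.arrowCongr (1 : E₂ ≃L[ℝ] E₂)).trans (ContinuousLinearEquiv.piRing (Fin d))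
  rw [← Function.id_comp f, ← e₂.symm_comp_self]
  exact e₂.symm.contDiff.contMDiff.contMDiffAt.comp x₀ (contMDiffAt_pi_space.2 fun i ↦ h _)

variable [IsManifold 𝓘(ℝ, E) ∞ M]

theorem SmoothVField.mdifferentiableAt {X : VField E M} (hX : SmoothVField X) (x : M) :
    MDiffAt (T% X) x :=
  ContMDiff.mdifferentiable hX (by simp) x

theorem SmoothOneForm.contMDiff_apply {θ : OneForm E M} (hθ : SmoothOneForm θ)
    {X : VField E M} (hX : SmoothVField X) :
    ContMDiff 𝓘(ℝ, E) 𝓘(ℝ, ℝ) ∞ (fun y ↦ θ y (X y)) := by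
  intro x
  have : ContMDiffAt 𝓘(ℝ, E) (𝓘(ℝ, E).prod 𝓘(ℝ, ℝ)) ∞
      (fun y ↦ Bundle.TotalSpace.mk' ℝ (E := Bundle.Trivial M ℝ) y (θ y (X y))) x :=
    ContMDiffAt.clm_bundle_apply (F₁ := E) (hθ x) (hX x)
  exact (Bundle.contMDiffAt_totalSpace.1 this).2

theorem SmoothCovTensor2.contMDiff_apply {T : CovTensor2 E M} (hT : SmoothCovTensor2 T)
    {X Y : VField E M} (hX : SmoothVField X) (hY : SmoothVField Y) :
    ContMDiff 𝓘(ℝ, E) 𝓘(ℝ, ℝ) ∞ (fun y ↦ T y (X y) (Y y)) := by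
  intro x
  have : ContMDiffAt 𝓘(ℝ, E) (𝓘(ℝ, E).prod 𝓘(ℝ, ℝ)) ∞
      (fun y ↦ Bundle.TotalSpace.mk' ℝ (E := Bundle.Trivial M ℝ) y (T y (X y) (Y y))) x :=
    ContMDiffAt.clm_bundle_apply₂ (F₁ := E) (F₂ := E) (hT x) (hX x) (hY x)
  exact (Bundle.contMDiffAt_totalSpace.1 this).2

/-- The tangent map of `f` composed with the section `X` is smooth, and its fibre component is
`df(X)`. -/
theorem contMDiff_mvfderiv_apply {f : M → ℝ} (hf : ContMDiff 𝓘(ℝ, E) 𝓘(ℝ, ℝ) ∞ f)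
    {X : VField E M} (hX : SmoothVField X) :
    ContMDiff 𝓘(ℝ, E) 𝓘(ℝ, ℝ) ∞ (fun y ↦ mvfderiv 𝓘(ℝ, E) f y (X y)) :=
  (contMDiff_snd_tangentBundle_modelSpace ℝ 𝓘(ℝ, ℝ)).comp
    ((hf.contMDiff_tangentMap (m := ∞) (by simp)).comp hX)

theorem SmoothVField.smul {f : M → ℝ} (hf : ContMDiff 𝓘(ℝ, E) 𝓘(ℝ, ℝ) ∞ f) {X : VField E M}
    (hX : SmoothVField X) : SmoothVField (f • X) :=
  ContMDiff.smul_section hf hX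

variable [FiniteDimensional ℝ E]

theorem SmoothVField.mlieBracket {X Y : VField E M} (hX : SmoothVField X) (hY : SmoothVField Y) :
    SmoothVField (mlieBracket 𝓘(ℝ, E) X Y) := by
  have : CompleteSpace E := FiniteDimensional.complete ℝ E
  have : IsManifold 𝓘(ℝ, E) (((⊤ : ℕ∞) : ℕ∞ω) + 1) M := by simpa using ‹IsManifold 𝓘(ℝ, E) ∞ M›
  have : IsManifold 𝓘(ℝ, E) (minSmoothness ℝ 2) M := by
    simpa using (inferInstance : IsManifold 𝓘(ℝ, E) 2 M)
  exact fun x ↦ ContMDiffAt.mlieBracket_vectorField (n := (⊤ : ℕ∞)) (m := (⊤ : ℕ∞)) (hX x) (hY x)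
    (by simp [minSmoothness_of_isRCLikeNormedField])

end Calculus

/-! ### Global extensions of vectors, and the bracket as a commutator. -/

section GlobalFrame

variable [IsManifold 𝓘(ℝ, E) ∞ M] [FiniteDimensional ℝ E] [T2Space M]

/-- Global smooth vector fields which near a given point are the frame of a trivialization. -/
theorem exists_smoothVField_eventuallyEq_symmL (x₀ : M) :
    ∃ W : E → VField E M, (∀ v, SmoothVField (W v)) ∧
      ∀ᶠ x in 𝓝 x₀, ∀ v,
        W v x = (trivializationAt E (TangentSpace 𝓘(ℝ, E)) x₀).symmL ℝ x v := by
  let t := trivializationAt E (TangentSpace 𝓘(ℝ, E) (M := M)) x₀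
  let f : SmoothBumpFunction 𝓘(ℝ, E) x₀ := Classical.arbitrary _
  -- A bump function supported in the chart extends the local frame by zero; the frame is unchanged
  -- where the bump equals 1.
  refine ⟨fun v x ↦ f x • t.symmL ℝ x v, fun v ↦ ?_, ?_⟩
  · refine ContMDiffOn.smul_section_of_tsupport (u := t.baseSet) (ψ := f)
      (s := fun x ↦ t.symmL ℝ x v) f.contMDiff.contMDiffOn t.open_baseSet ?_ ?_
    · exact f.tsupport_subset_chartAt_source
    · have hv : ContMDiff 𝓘(ℝ, E) (𝓘(ℝ, E).prod 𝓘(ℝ, E)) ∞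
          (fun y ↦ Bundle.TotalSpace.mk' E (E := Bundle.Trivial M E) y v) :=
        fun y ↦ Bundle.contMDiffAt_totalSpace.2 ⟨contMDiffAt_id, contMDiffAt_const⟩
      exact ContMDiffOn.clm_bundle_apply (F₁ := E) (F₂ := E) (E₁ := Bundle.Trivial M E)
        (v := fun _ ↦ v) t.contMDiffOn_symmL hv.contMDiffOn
  · filter_upwards [f.eventuallyEq_one] with x hx v
    simp [hx, t]

/-- This reduces a pointwise tensor identity to smooth fields, on which derivatives and brackets
make sense. -/
theorem exists_smoothVField_eq (x₀ : M) (v : TangentSpace 𝓘(ℝ, E) x₀) :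
    ∃ W : VField E M, SmoothVField W ∧ W x₀ = v := by
  obtain ⟨W, hW, h⟩ := exists_smoothVField_eventuallyEq_symmL (E := E) x₀
  refine ⟨W _, hW _, (h.self_of_nhds _).trans
    ((trivializationAt E (TangentSpace 𝓘(ℝ, E)) x₀).symmL_continuousLinearMapAt
      (FiberBundle.mem_baseSet_trivializationAt' x₀) v)⟩

/-- A field of endomorphisms of the tangent spaces is smooth if it maps smooth vector fields to
smooth vector fields. -/
theorem contMDiff_endomorphism_of_apply {A : Π x : M, TangentSpace 𝓘(ℝ, E) x →L[ℝ]
      TangentSpace 𝓘(ℝ, E) x}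
    (h : ∀ X : VField E M, SmoothVField X → SmoothVField fun x ↦ A x (X x)) :
    ContMDiff 𝓘(ℝ, E) (𝓘(ℝ, E).prod 𝓘(ℝ, E →L[ℝ] E)) ∞
      (fun x ↦ Bundle.TotalSpace.mk' (E →L[ℝ] E)
        (E := fun x : M ↦ TangentSpace 𝓘(ℝ, E) x →L[ℝ] TangentSpace 𝓘(ℝ, E) x) x (A x)) := by
  intro x₀
  obtain ⟨W, hW, hev⟩ := exists_smoothVField_eventuallyEq_symmL (E := E) x₀
  refine (contMDiffAt_hom_bundle _).2 ⟨contMDiffAt_id, contMDiffAt_clm_of_apply fun v ↦ ?_⟩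
  -- Near `x₀` the image of `v` under the coordinate expression of `A` is the coordinate vector of
  -- `A (W v)`.
  refine (Bundle.contMDiffAt_totalSpace.1 (h (W v) (hW v) x₀)).2.congr_of_eventuallyEq ?_
  filter_upwards [hev, (trivializationAt E (TangentSpace 𝓘(ℝ, E) (M := M)) x₀).open_baseSet.mem_nhds
    (FiberBundle.mem_baseSet_trivializationAt' x₀)] with x hx hb
  simp [ContinuousLinearMap.inCoordinates, hx v, Bundle.Trivialization.coe_linearMapAt_of_mem _ hb]

/-- The bracket of smooth vector fields is the commutator of the associated derivations. -/
theorem mvfderiv_mlieBracket {f : M → ℝ} (hf : ContMDiff 𝓘(ℝ, E) 𝓘(ℝ, ℝ) ∞ f) {X Y : VField E M}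
    (hX : SmoothVField X) (hY : SmoothVField Y) (x : M) :
    mvfderiv 𝓘(ℝ, E) f x (mlieBracket 𝓘(ℝ, E) X Y x) =
      mvfderiv 𝓘(ℝ, E) (fun y ↦ mvfderiv 𝓘(ℝ, E) f y (Y y)) x (X x)
        - mvfderiv 𝓘(ℝ, E) (fun y ↦ mvfderiv 𝓘(ℝ, E) f y (X y)) x (Y x) := by
  have : CompleteSpace E := FiniteDimensional.complete ℝ E
  have h2 : (2 : ℕ∞ω) ≤ ∞ := ENat.LEInfty.out
  have : IsManifold 𝓘(ℝ, E) (minSmoothness ℝ 3) M := by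
    simpa using (inferInstance : IsManifold 𝓘(ℝ, E) 3 M)
  -- The main argument reads off the coefficient of a nonzero vector, so a zero-dimensional tangent
  -- space is treated apart.
  rcases subsingleton_or_nontrivial (TangentSpace 𝓘(ℝ, E) x) with hs | hn
  · rw [Subsingleton.elim (mlieBracket 𝓘(ℝ, E) X Y x) 0, Subsingleton.elim (X x) 0,
      Subsingleton.elim (Y x) 0]
    simp
  obtain ⟨v, hv⟩ := exists_ne (0 : TangentSpace 𝓘(ℝ, E) x)
  obtain ⟨Z, hZ, rfl⟩ := exists_smoothVField_eq x v
  have hfd : MDifferentiable 𝓘(ℝ, E) 𝓘(ℝ, ℝ) f := hf.mdifferentiable (by simp)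
  have hd {W : VField E M} (hW : SmoothVField W) :=
    (contMDiff_mvfderiv_apply hf hW).mdifferentiable (by simp)
  have jac {Z : VField E M} (hZ : SmoothVField Z) :=
    leibniz_identity_mlieBracket_apply (I := 𝓘(ℝ, E)) (x := x) (U := X) (V := Y) (W := Z)
      ((hX x).of_le (by simpa using h2)) ((hY x).of_le (by simpa using h2))
      ((hZ x).of_le (by simpa using h2))
  have e {W : VField E M} : mlieBracket 𝓘(ℝ, E) W (f • Z) =
      (fun y ↦ mvfderiv 𝓘(ℝ, E) f y (W y)) • Z + f • mlieBracket 𝓘(ℝ, E) W Z := by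
    ext y
    rw [mlieBracket_smul_right (hfd y) (hZ.mdifferentiableAt y)]
    rfl
  have s1 {W : VField E M} (hW : SmoothVField W) :=
    SmoothVField.smul (contMDiff_mvfderiv_apply hf hW) hZ
  have s2 {W : VField E M} (hW : SmoothVField W) := SmoothVField.smul hf (hW.mlieBracket hZ)
  -- The Jacobi identity for `X, Y, f • Z`, minus `f` times the one for `X, Y, Z`, leaves a multiple
  -- of `Z x`. Its coefficient is the difference of the two sides of the claim.
  have h1 := jac (SmoothVField.smul hf hZ)
  rw [e, e, e, mlieBracket_add_right ((s1 hY).mdifferentiableAt x) ((s2 hY).mdifferentiableAt x),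
    mlieBracket_add_right ((s1 hX).mdifferentiableAt x) ((s2 hX).mdifferentiableAt x),
    mlieBracket_smul_right (hd hY x) (hZ.mdifferentiableAt x),
    mlieBracket_smul_right (hd hX x) (hZ.mdifferentiableAt x),
    mlieBracket_smul_right (hfd x) ((hY.mlieBracket hZ).mdifferentiableAt x),
    mlieBracket_smul_right (hfd x) ((hX.mlieBracket hZ).mdifferentiableAt x)] at h1
  simp only [Pi.add_apply, Pi.smul_apply', jac hZ] at h1
  rw [← sub_eq_zero]
  refine (smul_eq_zero.1 (?_ : _ • Z x = 0)).resolve_right hv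
  linear_combination (norm := module) (-1 : ℝ) • h1

end GlobalFrame

end HypersurfaceData

namespace MetricHypersurfaceData

theorem pairDual_apply {E : Type*} [NormedAddCommGroup E] [NormedSpace ℝ E]
    {M : Type*} [TopologicalSpace M] [ChartedSpace E M] {x : M}
    (α : TangentSpace 𝓘(ℝ, E) x →L[ℝ] ℝ) (a : ℝ) (p : TangentSpace 𝓘(ℝ, E) x × ℝ) :
    pairDual x α a p = α p.1 + a * p.2 := by
  simp [pairDual]

variable {E : Type*} [NormedAddCommGroup E] [NormedSpace ℝ E] [FiniteDimensional ℝ E]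
  {M : Type*} [TopologicalSpace M] [ChartedSpace E M] [IsManifold 𝓘(ℝ, E) ∞ M]
  (D : MetricHypersurfaceData E M)

/-! ### Pointwise algebra of `𝒜^♯`: contractions of `n` and `P` with `γ` and `ℓ`. -/

section Algebra

variable {x : M}

/-- An element of `T_x M × ℝ` is determined by its pairing with the ambient form. -/
theorem eq_of_ambient {v v' : TangentSpace 𝓘(ℝ, E) x} {a a' : ℝ}
    (h : ∀ w, D.γ x v w + a * D.ell x w = D.γ x v' w + a' * D.ell x w)
    (h' : D.ell x v + a * D.ell2 x = D.ell x v' + a' * D.ell2 x) : v = v' ∧ a = a' := by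
  have key (V) : D.sharp x (ambientForm D.γ D.ell D.ell2 x V) = V :=
    LinearEquiv.symm_apply_apply _ V
  have e : ambientForm D.γ D.ell D.ell2 x (v, a) = ambientForm D.γ D.ell D.ell2 x (v', a') := by
    ext w
    · simpa [ambientForm] using h w
    · simpa [ambientForm] using h'
  have := (key (v, a)).symm.trans ((congrArg _ e).trans (key (v', a')))
  exact Prod.mk.inj this

theorem γ_sharp (Φ : Module.Dual ℝ (TangentSpace 𝓘(ℝ, E) x × ℝ)) (w : TangentSpace 𝓘(ℝ, E) x) :
    D.γ x (D.sharp x Φ).1 w + (D.sharp x Φ).2 * D.ell x w = Φ (w, 0) := by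
  have h : ambientForm D.γ D.ell D.ell2 x (D.sharp x Φ) (w, 0) = Φ (w, 0) :=
    LinearMap.BilinForm.apply_toDual_symm_apply Φ _
  simpa [ambientForm] using h

theorem ell_sharp (Φ : Module.Dual ℝ (TangentSpace 𝓘(ℝ, E) x × ℝ)) :
    D.ell x (D.sharp x Φ).1 + (D.sharp x Φ).2 * D.ell2 x = Φ (0, 1) := by
  have h : ambientForm D.γ D.ell D.ell2 x (D.sharp x Φ) (0, 1) = Φ (0, 1) :=
    LinearMap.BilinForm.apply_toDual_symm_apply Φ _
  simpa [ambientForm] using h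

theorem γ_n (w : TangentSpace 𝓘(ℝ, E) x) : D.γ x (D.n x) w = -D.n2 x * D.ell x w := by
  have h := D.γ_sharp (pairDual x 0 1) w
  rw [pairDual_apply] at h
  simp only [zero_apply] at h
  simp only [n, n2]
  linear_combination h

theorem ell_n : D.ell x (D.n x) = 1 - D.n2 x * D.ell2 x := by
  have h := D.ell_sharp (pairDual x 0 1)
  rw [pairDual_apply] at h
  simp only [zero_apply] at h
  simp only [n, n2]
  linear_combination h

/-- The scalar component is the pairing with `(0, 1)`; by the symmetry of `𝒜^♯` it equals `(α, 0)`
paired with `(n, n⁽²⁾)`. -/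
theorem sharp_pairDual_snd (α : TangentSpace 𝓘(ℝ, E) x →L[ℝ] ℝ) :
    (D.sharp x (pairDual x α 0)).2 = α (D.n x) := by
  have h := D.ambientSharp_pairDual x 0 α 1 0
  have e : pairDual x (0 : TangentSpace 𝓘(ℝ, E) x →L[ℝ] ℝ) 0 = 0 := by
    ext <;> simp [pairDual]
  simpa [ambientSharp, pairDual_apply, P, Pvec, e] using h

theorem γ_Pvec (α : TangentSpace 𝓘(ℝ, E) x →L[ℝ] ℝ) (w : TangentSpace 𝓘(ℝ, E) x) :
    D.γ x (D.Pvec x α) w = α w - α (D.n x) * D.ell x w := by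
  have h := D.γ_sharp (pairDual x α 0) w
  rw [sharp_pairDual_snd] at h
  have e : pairDual x α 0 (w, 0) = α w := by simp [pairDual_apply]
  rw [e] at h
  simp only [Pvec]
  linear_combination h

theorem ell_Pvec (α : TangentSpace 𝓘(ℝ, E) x →L[ℝ] ℝ) :
    D.ell x (D.Pvec x α) = -α (D.n x) * D.ell2 x := by
  have h := D.ell_sharp (pairDual x α 0)
  rw [sharp_pairDual_snd] at h
  have e : pairDual x α 0 (0, 1) = 0 := by simp [pairDual_apply]
  rw [e] at h
  simp only [Pvec]
  linear_combination h

/-- Evaluate `γ(P(α, ·), P(β, ·))` in both orders: the correction term `α(n)β(n)ℓ⁽²⁾` is symmetric.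
-/
theorem P_comm (α β : TangentSpace 𝓘(ℝ, E) x →L[ℝ] ℝ) : D.P x α β = D.P x β α := by
  have h1 := D.γ_Pvec α (D.Pvec x β)
  have h2 := D.γ_Pvec β (D.Pvec x α)
  rw [D.symm_γ] at h2
  simp only [P]
  linear_combination h1 - h2 - α (D.n x) * D.ell_Pvec β + β (D.n x) * D.ell_Pvec α

theorem P_add_right (α β β' : TangentSpace 𝓘(ℝ, E) x →L[ℝ] ℝ) :
    D.P x α (β + β') = D.P x α β + D.P x α β' := rfl

theorem P_sub_right (α β β' : TangentSpace 𝓘(ℝ, E) x →L[ℝ] ℝ) :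
    D.P x α (β - β') = D.P x α β - D.P x α β' := rfl

theorem P_smul_right (α β : TangentSpace 𝓘(ℝ, E) x →L[ℝ] ℝ) (c : ℝ) :
    D.P x α (c • β) = c * D.P x α β := rfl

theorem P_sub_left (α α' β : TangentSpace 𝓘(ℝ, E) x →L[ℝ] ℝ) :
    D.P x (α - α') β = D.P x α β - D.P x α' β := by
  rw [P_comm, P_sub_right, P_comm, D.P_comm α']

theorem P_smul_left (α β : TangentSpace 𝓘(ℝ, E) x →L[ℝ] ℝ) (c : ℝ) :
    D.P x (c • α) β = c * D.P x α β := by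
  rw [P_comm, P_smul_right, P_comm]

end Algebra

/-! ### Smoothness of `n`, `n⁽²⁾` and `P`. -/

section Smoothness

variable [T2Space M]

/-- If the ambient form maps `(V, a)` to a smooth field, then `(V, a)` is smooth. -/
theorem smooth_of_ambient {V : VField E M} {a : M → ℝ}
    (h : ∀ W : VField E M, SmoothVField W → ContMDiff 𝓘(ℝ, E) 𝓘(ℝ, ℝ) ∞
      (fun x ↦ D.γ x (V x) (W x) + a x * D.ell x (W x)))
    (h' : ContMDiff 𝓘(ℝ, E) 𝓘(ℝ, ℝ) ∞ (fun x ↦ D.ell x (V x) + a x * D.ell2 x)) :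
    SmoothVField V ∧ ContMDiff 𝓘(ℝ, E) 𝓘(ℝ, ℝ) ∞ a := by
  suffices H : ∀ x₀, ContMDiffAt 𝓘(ℝ, E) (𝓘(ℝ, E).prod 𝓘(ℝ, E)) ∞
      (fun x ↦ Bundle.TotalSpace.mk' E x (V x)) x₀ ∧ ContMDiffAt 𝓘(ℝ, E) 𝓘(ℝ, ℝ) ∞ a x₀ from
    ⟨fun x ↦ (H x).1, fun x ↦ (H x).2⟩
  intro x₀
  obtain ⟨W, hW, hev⟩ := exists_smoothVField_eventuallyEq_symmL (E := E) x₀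
  set t := trivializationAt E (TangentSpace 𝓘(ℝ, E) (M := M)) x₀ with ht
  have hbase : ∀ᶠ x in 𝓝 x₀, x ∈ t.baseSet :=
    t.open_baseSet.mem_nhds (FiberBundle.mem_baseSet_trivializationAt' x₀)
  let S (x : M) : (E × ℝ) →ₗ[ℝ] TangentSpace 𝓘(ℝ, E) x × ℝ :=
    (t.symmL ℝ x).toLinearMap.prodMap LinearMap.id
  let A (x : M) : (E × ℝ) →L[ℝ] (E × ℝ) →L[ℝ] ℝ :=
    ((ambientForm D.γ D.ell D.ell2 x).compl₁₂ (S x) (S x)).toContinuousBilinearMap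
  have hA (x : M) (p q : E × ℝ) : A x p q = D.γ x (t.symmL ℝ x p.1) (t.symmL ℝ x q.1)
      + p.2 * D.ell x (t.symmL ℝ x q.1) + q.2 * D.ell x (t.symmL ℝ x p.1)
      + p.2 * q.2 * D.ell2 x := rfl
  -- Nondegeneracy makes `A x` injective, and its source and target have equal dimension.
  have hinv : ∀ x ∈ t.baseSet, ∃ e : (E × ℝ) ≃L[ℝ] ((E × ℝ) →L[ℝ] ℝ), (e : _ →L[ℝ] _) = A x := by
    intro x hx
    have hinj : Function.Injective (A x).toLinearMap := by
      refine (injective_iff_map_eq_zero _).2 fun p hp ↦ ?_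
      have hp' (q) : A x p q = 0 := congrArg (fun f : (E × ℝ) →L[ℝ] ℝ ↦ f q) hp
      have := D.eq_of_ambient (x := x) (v := t.symmL ℝ x p.1) (v' := 0) (a := p.2) (a' := 0)
        (fun w ↦ by
          have := hp' (t.continuousLinearMapAt ℝ x w, 0)
          rw [hA] at this
          simp only [t.symmL_continuousLinearMapAt hx] at this
          simpa using this)
        (by
          have := hp' (0, 1)
          rw [hA] at this
          simpa using this)
      refine Prod.ext ?_ this.2
      have h0 := congrArg (t.continuousLinearMapAt ℝ x) this.1
      rwa [t.continuousLinearMapAt_symmL hx, map_zero] at h0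
    have hdim : Module.finrank ℝ (E × ℝ) = Module.finrank ℝ ((E × ℝ) →L[ℝ] ℝ) := by
      rw [← LinearEquiv.finrank_eq (LinearMap.toContinuousLinearMap (𝕜 := ℝ) (E := E × ℝ)
        (F' := ℝ))]
      exact (Subspace.dual_finrank_eq (K := ℝ) (V := E × ℝ)).symm
    exact ⟨(LinearEquiv.ofInjectiveOfFinrankEq _ hinj hdim).toContinuousLinearEquiv,
      ContinuousLinearMap.ext fun _ ↦ rfl⟩
  have hAs : ContMDiffAt 𝓘(ℝ, E) 𝓘(ℝ, (E × ℝ) →L[ℝ] (E × ℝ) →L[ℝ] ℝ) ∞ A x₀ := by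
    refine contMDiffAt_clm_of_apply fun p ↦ contMDiffAt_clm_of_apply fun q ↦ ?_
    have := ((((D.smooth_γ.contMDiff_apply (hW p.1) (hW q.1)).add
      (contMDiff_const (c := p.2) |>.mul (D.smooth_ell.contMDiff_apply (hW q.1)))).add
      (contMDiff_const (c := q.2) |>.mul (D.smooth_ell.contMDiff_apply (hW p.1)))).add
      (contMDiff_const (c := p.2 * q.2) |>.mul D.smooth_ell2)) x₀
    refine this.congr_of_eventuallyEq ?_
    filter_upwards [hev] with x hx
    simp [hA, hx, ← ht]
  let v (x : M) : E × ℝ := (t.continuousLinearMapAt ℝ x (V x), a x)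
  have hφ : ContMDiffAt 𝓘(ℝ, E) 𝓘(ℝ, (E × ℝ) →L[ℝ] ℝ) ∞ (fun x ↦ A x (v x)) x₀ := by
    refine contMDiffAt_clm_of_apply fun q ↦ ?_
    have := ((h (W q.1) (hW q.1)).add (contMDiff_const (c := q.2) |>.mul h')) x₀
    refine this.congr_of_eventuallyEq ?_
    filter_upwards [hev, hbase] with x hx hb
    simp only [hA, hx, v, t.symmL_continuousLinearMapAt hb, Pi.add_apply, Pi.mul_apply]
    ring
  -- Near `x₀`, `v` is the inverse of `A` applied to the smooth covector `A v`, and inversion is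
  -- smooth at an invertible operator.
  have hv : ContMDiffAt 𝓘(ℝ, E) 𝓘(ℝ, E × ℝ) ∞ v x₀ := by
    obtain ⟨e, he⟩ := hinv x₀ hbase.self_of_nhds
    have hi : ContMDiffAt 𝓘(ℝ, E) 𝓘(ℝ, ((E × ℝ) →L[ℝ] ℝ) →L[ℝ] (E × ℝ)) ∞
        (fun x ↦ (A x).inverse) x₀ := by
      have := contDiffAt_map_inverse (n := ∞) e
      rw [he] at this
      exact this.contMDiffAt.comp x₀ hAs
    refine (hi.clm_apply hφ).congr_of_eventuallyEq ?_
    filter_upwards [hbase] with x hb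
    obtain ⟨e, he⟩ := hinv x hb
    simp [← he]
  have hv1 := contDiff_fst.contMDiff.contMDiffAt.comp x₀ hv
  have hv2 := contDiff_snd.contMDiff.contMDiffAt.comp x₀ hv
  refine ⟨Bundle.contMDiffAt_totalSpace.2 ⟨contMDiffAt_id, ?_⟩, hv2⟩
  refine hv1.congr_of_eventuallyEq ?_
  filter_upwards [hbase] with x hb
  simp [v, t.coe_linearMapAt_of_mem hb, ← ht]

/-- The ambient form sends `(n, n⁽²⁾)` to the constant covector `(0, 1)`. -/
theorem smooth_n_n2 : SmoothVField D.n ∧ ContMDiff 𝓘(ℝ, E) 𝓘(ℝ, ℝ) ∞ D.n2 := by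
  refine D.smooth_of_ambient (fun W _ ↦ ?_) ?_
  · simpa [D.γ_n] using contMDiff_const
  · simpa [D.ell_n] using contMDiff_const

theorem smooth_n : SmoothVField D.n := D.smooth_n_n2.1

theorem smooth_n2 : ContMDiff 𝓘(ℝ, E) 𝓘(ℝ, ℝ) ∞ D.n2 := D.smooth_n_n2.2

theorem smooth_Pvec {α : OneForm E M} (hα : SmoothOneForm α) :
    SmoothVField fun x ↦ D.Pvec x (α x) := by
  refine (D.smooth_of_ambient (a := fun x ↦ α x (D.n x)) (fun W hW ↦ ?_) ?_).1
  · simpa [D.γ_Pvec] using hα.contMDiff_apply hW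
  · simpa [D.ell_Pvec] using contMDiff_const

end Smoothness

end MetricHypersurfaceData

/-! ### Derivation rules for scalar functions, evaluated on a vector. -/

namespace HypersurfaceData

variable {E : Type*} [NormedAddCommGroup E] [NormedSpace ℝ E]
  {M : Type*} [TopologicalSpace M] [ChartedSpace E M] {x : M}

theorem mdifferentiableAt_fun_add {f g : M → ℝ}
    (hf : MDifferentiableAt 𝓘(ℝ, E) 𝓘(ℝ, ℝ) f x) (hg : MDifferentiableAt 𝓘(ℝ, E) 𝓘(ℝ, ℝ) g x) :
    MDifferentiableAt 𝓘(ℝ, E) 𝓘(ℝ, ℝ) (fun y ↦ f y + g y) x :=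
  hf.add hg

theorem mdifferentiableAt_fun_sub {f g : M → ℝ}
    (hf : MDifferentiableAt 𝓘(ℝ, E) 𝓘(ℝ, ℝ) f x) (hg : MDifferentiableAt 𝓘(ℝ, E) 𝓘(ℝ, ℝ) g x) :
    MDifferentiableAt 𝓘(ℝ, E) 𝓘(ℝ, ℝ) (fun y ↦ f y - g y) x :=
  hf.sub hg

theorem mdifferentiableAt_fun_mul {f g : M → ℝ}
    (hf : MDifferentiableAt 𝓘(ℝ, E) 𝓘(ℝ, ℝ) f x) (hg : MDifferentiableAt 𝓘(ℝ, E) 𝓘(ℝ, ℝ) g x) :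
    MDifferentiableAt 𝓘(ℝ, E) 𝓘(ℝ, ℝ) (fun y ↦ f y * g y) x :=
  hf.mul hg

theorem mvfderiv_add_apply {f g : M → ℝ} (hf : MDifferentiableAt 𝓘(ℝ, E) 𝓘(ℝ, ℝ) f x)
    (hg : MDifferentiableAt 𝓘(ℝ, E) 𝓘(ℝ, ℝ) g x) (v : TangentSpace 𝓘(ℝ, E) x) :
    mvfderiv 𝓘(ℝ, E) (fun y ↦ f y + g y) x v =
      mvfderiv 𝓘(ℝ, E) f x v + mvfderiv 𝓘(ℝ, E) g x v := by
  rw [mvfderiv_fun_add hf hg]; rfl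

theorem mvfderiv_sub_apply {f g : M → ℝ} (hf : MDifferentiableAt 𝓘(ℝ, E) 𝓘(ℝ, ℝ) f x)
    (hg : MDifferentiableAt 𝓘(ℝ, E) 𝓘(ℝ, ℝ) g x) (v : TangentSpace 𝓘(ℝ, E) x) :
    mvfderiv 𝓘(ℝ, E) (fun y ↦ f y - g y) x v =
      mvfderiv 𝓘(ℝ, E) f x v - mvfderiv 𝓘(ℝ, E) g x v := by
  rw [mvfderiv_fun_sub hf hg]; rfl

theorem mvfderiv_mul_apply {f g : M → ℝ} (hf : MDifferentiableAt 𝓘(ℝ, E) 𝓘(ℝ, ℝ) f x)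
    (hg : MDifferentiableAt 𝓘(ℝ, E) 𝓘(ℝ, ℝ) g x) (v : TangentSpace 𝓘(ℝ, E) x) :
    mvfderiv 𝓘(ℝ, E) (fun y ↦ f y * g y) x v =
      f x * mvfderiv 𝓘(ℝ, E) g x v + g x * mvfderiv 𝓘(ℝ, E) f x v := by
  rw [mvfderiv_fun_mul hf hg]; rfl

theorem mvfderiv_const_mul_apply (c : ℝ) {f : M → ℝ}
    (hf : MDifferentiableAt 𝓘(ℝ, E) 𝓘(ℝ, ℝ) f x) (v : TangentSpace 𝓘(ℝ, E) x) :
    mvfderiv 𝓘(ℝ, E) (fun y ↦ c * f y) x v = c * mvfderiv 𝓘(ℝ, E) f x v := by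
  rw [mvfderiv_mul_apply mdifferentiableAt_const hf, mvfderiv_const]
  simp

theorem mvfderiv_const_apply (c : ℝ) (v : TangentSpace 𝓘(ℝ, E) x) :
    mvfderiv 𝓘(ℝ, E) (fun _ ↦ c) x v = 0 := by
  rw [mvfderiv_const]; rfl

end HypersurfaceData

/-! ### The tensors `F` and `U`, and their contractions with `n`. -/

namespace MetricHypersurfaceData

variable {E : Type*} [NormedAddCommGroup E] [NormedSpace ℝ E] [FiniteDimensional ℝ E]
  {M : Type*} [TopologicalSpace M] [ChartedSpace E M] [IsManifold 𝓘(ℝ, E) ∞ M]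
  (D : MetricHypersurfaceData E M) {x : M}

theorem F_apply {X Y : VField E M} (hX : MDiffAt (T% X) x) (hY : MDiffAt (T% Y) x) :
    D.F x (X x) (Y x) = 1 / 2 * (mvfderiv 𝓘(ℝ, E) (fun y ↦ D.ell y (Y y)) x (X x)
      - mvfderiv 𝓘(ℝ, E) (fun y ↦ D.ell y (X y)) x (Y x)
      - D.ell x (mlieBracket 𝓘(ℝ, E) X Y x)) := by
  have := extDerivTensor_apply D.smooth_ell hX hY
  simp only [F, smul_apply, this, extDerivOneForm, smul_eq_mul]

theorem U_apply {X Y : VField E M} (hX : MDiffAt (T% X) x) (hY : MDiffAt (T% Y) x) :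
    D.U x (X x) (Y x) = 1 / 2 * (mvfderiv 𝓘(ℝ, E) (fun y ↦ D.γ y (X y) (Y y)) x (D.n x)
      - D.γ x (mlieBracket 𝓘(ℝ, E) D.n X x) (Y x) - D.γ x (X x) (mlieBracket 𝓘(ℝ, E) D.n Y x))
      + 1 / 2 * (D.ell x (X x) * diff D.n2 x (Y x) + diff D.n2 x (X x) * D.ell x (Y x)) := by
  have := lieTensor_apply D.n D.smooth_γ hX hY
  simp only [U, add_apply, smul_apply, this, lieCovTensor2,
    smul_eq_mul, ContinuousLinearMap.smulRight_apply]

theorem s_apply (v : TangentSpace 𝓘(ℝ, E) x) : D.s x v = D.F x (D.n x) v := rfl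

theorem ell2U_apply (v w : TangentSpace 𝓘(ℝ, E) x) :
    D.ell2U x v w = D.ell2 x * D.U x v w := rfl

theorem contMDiff_F_apply {X Y : VField E M} (hX : SmoothVField X) (hY : SmoothVField Y) :
    ContMDiff 𝓘(ℝ, E) 𝓘(ℝ, ℝ) ∞ (fun y ↦ D.F y (X y) (Y y)) := by
  simp only [D.F_apply (hX.mdifferentiableAt _) (hY.mdifferentiableAt _)]
  exact contMDiff_const.mul
    (((contMDiff_mvfderiv_apply (D.smooth_ell.contMDiff_apply hY) hX).sub
      (contMDiff_mvfderiv_apply (D.smooth_ell.contMDiff_apply hX) hY)).sub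
      (D.smooth_ell.contMDiff_apply (hX.mlieBracket hY)))

theorem mdifferentiableAt_F_apply {X Y : VField E M} (hX : SmoothVField X) (hY : SmoothVField Y) :
    MDifferentiableAt 𝓘(ℝ, E) 𝓘(ℝ, ℝ) (fun y ↦ D.F y (X y) (Y y)) x :=
  (D.contMDiff_F_apply hX hY).mdifferentiable (by simp) x

variable [T2Space M]

theorem mdifferentiableAt_n2 : MDifferentiableAt 𝓘(ℝ, E) 𝓘(ℝ, ℝ) D.n2 x :=
  D.smooth_n2.mdifferentiable (by simp) x

theorem mdifferentiableAt_n : MDiffAt (T% D.n) x :=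
  D.smooth_n.mdifferentiableAt x

theorem F_swap (v w : TangentSpace 𝓘(ℝ, E) x) : D.F x v w = -D.F x w v := by
  obtain ⟨V, hV, rfl⟩ := exists_smoothVField_eq x v
  obtain ⟨W, hW, rfl⟩ := exists_smoothVField_eq x w
  rw [D.F_apply (hV.mdifferentiableAt x) (hW.mdifferentiableAt x),
    D.F_apply (hW.mdifferentiableAt x) (hV.mdifferentiableAt x), mlieBracket_swap_apply, map_neg]
  ring

theorem U_comm (v w : TangentSpace 𝓘(ℝ, E) x) : D.U x v w = D.U x w v := by
  obtain ⟨V, hV, rfl⟩ := exists_smoothVField_eq x v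
  obtain ⟨W, hW, rfl⟩ := exists_smoothVField_eq x w
  rw [D.U_apply (hV.mdifferentiableAt x) (hW.mdifferentiableAt x),
    D.U_apply (hW.mdifferentiableAt x) (hV.mdifferentiableAt x)]
  simp only [D.symm_γ _ (V _) _, D.symm_γ x (W x) (mlieBracket 𝓘(ℝ, E) D.n V x)]
  ring

theorem leftSlot_F (v : TangentSpace 𝓘(ℝ, E) x) : leftSlot D.F x v = -D.F x v := by
  ext w
  exact D.F_swap w v

theorem s_n : D.s x (D.n x) = 0 := by
  have := D.F_swap (D.n x) (D.n x)
  rw [s_apply]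
  linarith

/-- As `γ(·, n) = -n⁽²⁾ℓ` and `[n, n] = 0`, contracting `£_n γ` with `n` gives `-£_n(n⁽²⁾ℓ)`.
Cartan's formula `£_n ℓ = 2ŝ + d(ℓ(n))` with `ℓ(n) = 1 - n⁽²⁾ℓ⁽²⁾` supplies the rest. -/
theorem U_n (v : TangentSpace 𝓘(ℝ, E) x) :
    D.U x v (D.n x) = -D.n2 x * D.s x v + 1 / 2 * D.n2 x ^ 2 * diff D.ell2 x v
      + 1 / 2 * diff D.n2 x v := by
  obtain ⟨V, hV, rfl⟩ := exists_smoothVField_eq x v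
  have hVd := hV.mdifferentiableAt x
  have hγ : (fun y ↦ D.γ y (V y) (D.n y)) = fun y ↦ -1 * (D.n2 y * D.ell y (V y)) := by
    ext y; rw [D.symm_γ, γ_n]; ring
  have hl : (fun y ↦ D.ell y (D.n y)) = fun y ↦ 1 - D.n2 y * D.ell2 y := by
    ext y; rw [ell_n]
  have h1 := D.smooth_ell.mdifferentiableAt_apply hVd
  have h2 := D.mdifferentiableAt_n2 (x := x)
  have h3 := D.smooth_ell2.mdifferentiable (by simp) x
  have h21 := mdifferentiableAt_fun_mul h2 h1
  have h23 := mdifferentiableAt_fun_mul h2 h3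
  rw [s_apply, D.F_apply D.mdifferentiableAt_n hVd, D.U_apply hVd D.mdifferentiableAt_n, hγ, hl,
    mvfderiv_const_mul_apply _ h21, mvfderiv_mul_apply h2 h1,
    mvfderiv_sub_apply mdifferentiableAt_const h23, mvfderiv_const_apply,
    mvfderiv_mul_apply h2 h3, mlieBracket_self, D.symm_γ _ _ (D.n x), γ_n, ell_n]
  simp only [diff, Pi.zero_apply, map_zero]
  ring

theorem contMDiff_U_apply {X Y : VField E M} (hX : SmoothVField X) (hY : SmoothVField Y) :
    ContMDiff 𝓘(ℝ, E) 𝓘(ℝ, ℝ) ∞ (fun y ↦ D.U y (X y) (Y y)) := by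
  simp only [D.U_apply (hX.mdifferentiableAt _) (hY.mdifferentiableAt _)]
  have hn := D.smooth_n
  exact (contMDiff_const.mul
    (((contMDiff_mvfderiv_apply (D.smooth_γ.contMDiff_apply hX hY) hn).sub
      (D.smooth_γ.contMDiff_apply (hn.mlieBracket hX) hY)).sub
      (D.smooth_γ.contMDiff_apply hX (hn.mlieBracket hY)))).add
    (contMDiff_const.mul
      (((D.smooth_ell.contMDiff_apply hX).mul (contMDiff_mvfderiv_apply D.smooth_n2 hY)).add
        ((contMDiff_mvfderiv_apply D.smooth_n2 hX).mul (D.smooth_ell.contMDiff_apply hY))))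

theorem mdifferentiableAt_U_apply {X Y : VField E M} (hX : SmoothVField X) (hY : SmoothVField Y) :
    MDifferentiableAt 𝓘(ℝ, E) 𝓘(ℝ, ℝ) (fun y ↦ D.U y (X y) (Y y)) x :=
  (D.contMDiff_U_apply hX hY).mdifferentiable (by simp) x

end MetricHypersurfaceData

/-! ### Structure equations, Ricci identities and the derivative of `n`. -/

namespace HypersurfaceData

variable {E : Type*} [NormedAddCommGroup E] [NormedSpace ℝ E]
  {M : Type*} [TopologicalSpace M] [ChartedSpace E M] [IsManifold 𝓘(ℝ, E) ∞ M]

theorem smooth_nablaVec {nabla : AffineConnection E M}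
    (h : CovariantDerivative.ContMDiffCovariantDerivative nabla ∞) {X Z : VField E M}
    (hX : SmoothVField X) (hZ : SmoothVField Z) : SmoothVField (nablaVec nabla X Z) := by
  have h1 := h.contMDiff.contMDiff (σ := Z) (by simpa using ContMDiff.contMDiffOn hZ)
  exact fun x ↦ ContMDiffAt.clm_bundle_apply (F₁ := E) (F₂ := E)
    (contMDiffOn_univ.1 h1 x) (hX x)

/-- The Hessian of a function with respect to a torsion-free connection is symmetric. -/
theorem nablaOneForm_diff_comm [FiniteDimensional ℝ E] [T2Space M] {nabla : AffineConnection E M}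
    (ht : nabla.torsion = 0) {f : M → ℝ} (hf : ContMDiff 𝓘(ℝ, E) 𝓘(ℝ, ℝ) ∞ f) {X Y : VField E M}
    (hX : SmoothVField X) (hY : SmoothVField Y) (x : M) :
    nablaOneForm nabla (diff f) X Y x = nablaOneForm nabla (diff f) Y X x := by
  have : CompleteSpace E := FiniteDimensional.complete ℝ E
  have h1 := mvfderiv_mlieBracket hf hX hY x
  rw [← CovariantDerivative.torsion_eq_zero_iff _ |>.1 ht (hX.mdifferentiableAt x)
    (hY.mdifferentiableAt x), map_sub] at h1
  simp only [nablaOneForm, nablaVec, diff]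
  linear_combination -h1

end HypersurfaceData

namespace MetricHypersurfaceData.IsMetricHypersurfaceConnection

variable {E : Type*} [NormedAddCommGroup E] [NormedSpace ℝ E] [FiniteDimensional ℝ E]
  {M : Type*} [TopologicalSpace M] [ChartedSpace E M] [IsManifold 𝓘(ℝ, E) ∞ M]
  {D : MetricHypersurfaceData E M} {nabla : AffineConnection E M}

theorem nablaVec_sub (h : D.IsMetricHypersurfaceConnection nabla) {X Y : VField E M} {x : M}
    (hX : MDiffAt (T% X) x) (hY : MDiffAt (T% Y) x) :
    mlieBracket 𝓘(ℝ, E) X Y x = nablaVec nabla X Y x - nablaVec nabla Y X x :=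
  have : CompleteSpace E := FiniteDimensional.complete ℝ E
  (CovariantDerivative.torsion_eq_zero_iff _ |>.1 h.torsion_free hX hY).symm

theorem smooth_nablaVec (h : D.IsMetricHypersurfaceConnection nabla) {X Z : VField E M}
    (hX : SmoothVField X) (hZ : SmoothVField Z) : SmoothVField (nablaVec nabla X Z) :=
  HypersurfaceData.smooth_nablaVec h.smooth hX hZ

/-- The symmetric part of `∇ℓ` is prescribed by the definition of the connection; without torsion
its antisymmetric part is `F`. -/
theorem mvfderiv_ell (h : D.IsMetricHypersurfaceConnection nabla) {X Z : VField E M} {x : M}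
    (hX : MDiffAt (T% X) x) (hZ : MDiffAt (T% Z) x) :
    mvfderiv 𝓘(ℝ, E) (fun y ↦ D.ell y (Z y)) x (X x) =
      D.ell x (nablaVec nabla X Z x) + D.F x (X x) (Z x) - D.ell2 x * D.U x (X x) (Z x) := by
  have h1 := h.nabla_ell x X Z hX hZ
  have h2 := D.F_apply hX hZ
  rw [h.nablaVec_sub hX hZ, map_sub] at h2
  simp only [nablaOneForm] at h1
  linear_combination h1 / 2 - h2

theorem mvfderiv_γ (h : D.IsMetricHypersurfaceConnection nabla) {X Z W : VField E M} {x : M}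
    (hX : MDiffAt (T% X) x) (hZ : MDiffAt (T% Z) x) (hW : MDiffAt (T% W) x) :
    mvfderiv 𝓘(ℝ, E) (fun y ↦ D.γ y (Z y) (W y)) x (X x) =
      D.γ x (nablaVec nabla X Z x) (W x) + D.γ x (Z x) (nablaVec nabla X W x)
        - D.U x (X x) (Z x) * D.ell x (W x) - D.U x (X x) (W x) * D.ell x (Z x) := by
  have h1 := h.nabla_γ x X Z W hX hZ hW
  simp only [nablaCovTensor2] at h1
  linear_combination h1

variable [T2Space M]

theorem nablaCovTensor2_ell2U {X Y Z : VField E M}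
    (hY : SmoothVField Y) (hZ : SmoothVField Z) (x : M) :
    nablaCovTensor2 nabla D.ell2U X Y Z x = diff D.ell2 x (X x) * D.U x (Y x) (Z x)
      + D.ell2 x * nablaCovTensor2 nabla D.U X Y Z x := by
  have h1 := mvfderiv_mul_apply (D.smooth_ell2.mdifferentiable (by simp) x)
    (D.mdifferentiableAt_U_apply hY hZ (x := x)) (X x)
  simp only [nablaCovTensor2, ell2U_apply, diff, h1]
  ring

/-- The Ricci identity for `ℓ`. -/
theorem ell_curvature_aux (h : D.IsMetricHypersurfaceConnection nabla) {X Y Z : VField E M}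
    (hX : SmoothVField X) (hY : SmoothVField Y) (hZ : SmoothVField Z) (x : M) :
    D.ell x (curvature nabla X Y Z x) =
      nablaCovTensor2 nabla D.F Y X Z x - nablaCovTensor2 nabla D.F X Y Z x
        + nablaCovTensor2 nabla D.ell2U X Y Z x - nablaCovTensor2 nabla D.ell2U Y X Z x := by
  -- The structure equation holds at every point, so it may be differentiated a second time.
  have e {V : VField E M} (hV : SmoothVField V) :
      (fun y ↦ mvfderiv 𝓘(ℝ, E) (fun z ↦ D.ell z (Z z)) y (V y)) = fun y ↦
        D.ell y (nablaVec nabla V Z y) + D.F y (V y) (Z y) - D.ell2 y * D.U y (V y) (Z y) := by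
    ext y; exact h.mvfderiv_ell (hV.mdifferentiableAt y) (hZ.mdifferentiableAt y)
  have d {V W : VField E M} (hV : SmoothVField V) (hW : SmoothVField W) :
      mvfderiv 𝓘(ℝ, E) (fun y ↦ D.ell y (nablaVec nabla V Z y) + D.F y (V y) (Z y)
        - D.ell2 y * D.U y (V y) (Z y)) x (W x) =
      (D.ell x (nablaVec nabla W (nablaVec nabla V Z) x)
        + D.F x (W x) (nablaVec nabla V Z x) - D.ell2 x * D.U x (W x) (nablaVec nabla V Z x))
      + mvfderiv 𝓘(ℝ, E) (fun y ↦ D.F y (V y) (Z y)) x (W x)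
      - mvfderiv 𝓘(ℝ, E) (fun y ↦ D.ell2 y * D.U y (V y) (Z y)) x (W x) := by
    have hVZ := (h.smooth_nablaVec hV hZ).mdifferentiableAt x
    have m1 := D.smooth_ell.mdifferentiableAt_apply hVZ
    have m2 := D.mdifferentiableAt_F_apply hV hZ (x := x)
    have m3 := mdifferentiableAt_fun_mul (D.smooth_ell2.mdifferentiable (by simp) x)
      (D.mdifferentiableAt_U_apply hV hZ (x := x))
    rw [mvfderiv_sub_apply (mdifferentiableAt_fun_add m1 m2) m3, mvfderiv_add_apply m1 m2,
      h.mvfderiv_ell (hW.mdifferentiableAt x) hVZ]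
  -- `[X, Y]` acts on the scalar `ℓ(Z)` as a commutator; expanding both sides isolates `ℓ` of the
  -- curvature.
  have c := mvfderiv_mlieBracket (D.smooth_ell.contMDiff_apply hZ) hX hY x
  have hb := h.mvfderiv_ell ((hX.mlieBracket hY).mdifferentiableAt x) (hZ.mdifferentiableAt x)
  rw [e hX, e hY, d hX hY, d hY hX, hb,
    h.nablaVec_sub (hX.mdifferentiableAt x) (hY.mdifferentiableAt x)] at c
  simp only [curvature, map_sub, nablaCovTensor2, ell2U_apply, sub_apply] at c ⊢
  linear_combination -c

/-- The Ricci identity for `γ`. -/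
theorem γ_curvature (h : D.IsMetricHypersurfaceConnection nabla) {X Y Z W : VField E M}
    (hX : SmoothVField X) (hY : SmoothVField Y) (hZ : SmoothVField Z) (hW : SmoothVField W)
    (x : M) :
    D.γ x (curvature nabla X Y Z x) (W x) + D.γ x (Z x) (curvature nabla X Y W x) =
      (nablaCovTensor2 nabla D.U X Y Z x - nablaCovTensor2 nabla D.U Y X Z x) * D.ell x (W x)
      + (nablaCovTensor2 nabla D.U X Y W x - nablaCovTensor2 nabla D.U Y X W x) * D.ell x (Z x)
      + D.U x (Y x) (Z x) * (D.F x (X x) (W x) - D.ell2 x * D.U x (X x) (W x))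
      + D.U x (Y x) (W x) * (D.F x (X x) (Z x) - D.ell2 x * D.U x (X x) (Z x))
      - D.U x (X x) (Z x) * (D.F x (Y x) (W x) - D.ell2 x * D.U x (Y x) (W x))
      - D.U x (X x) (W x) * (D.F x (Y x) (Z x) - D.ell2 x * D.U x (Y x) (Z x)) := by
  have e {V : VField E M} (hV : SmoothVField V) :
      (fun y ↦ mvfderiv 𝓘(ℝ, E) (fun z ↦ D.γ z (Z z) (W z)) y (V y)) = fun y ↦
        D.γ y (nablaVec nabla V Z y) (W y) + D.γ y (Z y) (nablaVec nabla V W y)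
        - D.U y (V y) (Z y) * D.ell y (W y) - D.U y (V y) (W y) * D.ell y (Z y) := by
    ext y
    exact h.mvfderiv_γ (hV.mdifferentiableAt y) (hZ.mdifferentiableAt y) (hW.mdifferentiableAt y)
  have d {V T : VField E M} (hV : SmoothVField V) (hT : SmoothVField T) :
      mvfderiv 𝓘(ℝ, E) (fun y ↦ D.γ y (nablaVec nabla V Z y) (W y)
        + D.γ y (Z y) (nablaVec nabla V W y)
        - D.U y (V y) (Z y) * D.ell y (W y) - D.U y (V y) (W y) * D.ell y (Z y)) x (T x) =
      (D.γ x (nablaVec nabla T (nablaVec nabla V Z) x) (W x)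
        + D.γ x (nablaVec nabla V Z x) (nablaVec nabla T W x)
        - D.U x (T x) (nablaVec nabla V Z x) * D.ell x (W x)
        - D.U x (T x) (W x) * D.ell x (nablaVec nabla V Z x))
      + (D.γ x (nablaVec nabla T Z x) (nablaVec nabla V W x)
        + D.γ x (Z x) (nablaVec nabla T (nablaVec nabla V W) x)
        - D.U x (T x) (Z x) * D.ell x (nablaVec nabla V W x)
        - D.U x (T x) (nablaVec nabla V W x) * D.ell x (Z x))
      - (D.U x (V x) (Z x) * (D.ell x (nablaVec nabla T W x) + D.F x (T x) (W x)
          - D.ell2 x * D.U x (T x) (W x))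
        + D.ell x (W x) * mvfderiv 𝓘(ℝ, E) (fun y ↦ D.U y (V y) (Z y)) x (T x))
      - (D.U x (V x) (W x) * (D.ell x (nablaVec nabla T Z x) + D.F x (T x) (Z x)
          - D.ell2 x * D.U x (T x) (Z x))
        + D.ell x (Z x) * mvfderiv 𝓘(ℝ, E) (fun y ↦ D.U y (V y) (W y)) x (T x)) := by
    have hVZ := (h.smooth_nablaVec hV hZ).mdifferentiableAt x
    have hVW := (h.smooth_nablaVec hV hW).mdifferentiableAt x
    have hZx := hZ.mdifferentiableAt x
    have hWx := hW.mdifferentiableAt x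
    have hTx := hT.mdifferentiableAt x
    have m1 := D.smooth_γ.mdifferentiableAt_apply hVZ hWx
    have m2 := D.smooth_γ.mdifferentiableAt_apply hZx hVW
    have m3 := D.mdifferentiableAt_U_apply hV hZ (x := x)
    have m4 := D.mdifferentiableAt_U_apply hV hW (x := x)
    have m5 := D.smooth_ell.mdifferentiableAt_apply hWx
    have m6 := D.smooth_ell.mdifferentiableAt_apply hZx
    rw [mvfderiv_sub_apply (mdifferentiableAt_fun_sub (mdifferentiableAt_fun_add m1 m2)
      (mdifferentiableAt_fun_mul m3 m5)) (mdifferentiableAt_fun_mul m4 m6),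
      mvfderiv_sub_apply (mdifferentiableAt_fun_add m1 m2) (mdifferentiableAt_fun_mul m3 m5),
      mvfderiv_add_apply m1 m2,
      mvfderiv_mul_apply m3 m5, mvfderiv_mul_apply m4 m6, h.mvfderiv_γ hTx hVZ hWx,
      h.mvfderiv_γ hTx hZx hVW, h.mvfderiv_ell hTx hWx, h.mvfderiv_ell hTx hZx]
  have c := mvfderiv_mlieBracket (D.smooth_γ.contMDiff_apply hZ hW) hX hY x
  have hb := h.mvfderiv_γ ((hX.mlieBracket hY).mdifferentiableAt x) (hZ.mdifferentiableAt x)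
    (hW.mdifferentiableAt x)
  rw [e hX, e hY, d hX hY, d hY hX, hb,
    h.nablaVec_sub (hX.mdifferentiableAt x) (hY.mdifferentiableAt x)] at c
  simp only [curvature, map_sub, nablaCovTensor2, sub_apply] at c ⊢
  linear_combination -c

/-- `F` is closed. -/
theorem nabla_F_cyclic (h : D.IsMetricHypersurfaceConnection nabla) {X Y Z : VField E M}
    (hX : SmoothVField X) (hY : SmoothVField Y) (hZ : SmoothVField Z) (x : M) :
    nablaCovTensor2 nabla D.F X Y Z x + nablaCovTensor2 nabla D.F Y Z X x
      + nablaCovTensor2 nabla D.F Z X Y x = 0 := by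
  have : CompleteSpace E := FiniteDimensional.complete ℝ E
  have h2 : (2 : ℕ∞ω) ≤ ∞ := ENat.LEInfty.out
  have : IsManifold 𝓘(ℝ, E) (minSmoothness ℝ 3) M := by
    simpa using (inferInstance : IsManifold 𝓘(ℝ, E) 3 M)
  -- This is `d(dℓ) = 0`: in the cyclic sum the iterated derivatives cancel and the double brackets
  -- vanish by the Jacobi identity.
  have jac := leibniz_identity_mlieBracket_apply (I := 𝓘(ℝ, E)) (x := x) (U := X) (V := Y) (W := Z)
      ((hX x).of_le (by simpa using h2)) ((hY x).of_le (by simpa using h2))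
      ((hZ x).of_le (by simpa using h2))
  have d {V W T : VField E M} (hV : SmoothVField V) (hW : SmoothVField W) (hT : SmoothVField T) :
      mvfderiv 𝓘(ℝ, E) (fun y ↦ D.F y (V y) (W y)) x (T x) = 1 / 2 *
        (mvfderiv 𝓘(ℝ, E) (fun y ↦ mvfderiv 𝓘(ℝ, E) (fun y ↦ D.ell y (W y)) y (V y)) x (T x)
        - mvfderiv 𝓘(ℝ, E) (fun y ↦ mvfderiv 𝓘(ℝ, E) (fun y ↦ D.ell y (V y)) y (W y)) x (T x)
        - mvfderiv 𝓘(ℝ, E) (fun y ↦ D.ell y (mlieBracket 𝓘(ℝ, E) V W y)) x (T x)) := by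
    have e : (fun y ↦ D.F y (V y) (W y)) = fun y ↦ 1 / 2 *
        (mvfderiv 𝓘(ℝ, E) (fun y ↦ D.ell y (W y)) y (V y)
        - mvfderiv 𝓘(ℝ, E) (fun y ↦ D.ell y (V y)) y (W y)
        - D.ell y (mlieBracket 𝓘(ℝ, E) V W y)) := by
      ext y; exact D.F_apply (hV.mdifferentiableAt y) (hW.mdifferentiableAt y)
    have m1 := (contMDiff_mvfderiv_apply (D.smooth_ell.contMDiff_apply hW) hV).mdifferentiable
      (by simp) x
    have m2 := (contMDiff_mvfderiv_apply (D.smooth_ell.contMDiff_apply hV) hW).mdifferentiable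
      (by simp) x
    have m3 := D.smooth_ell.mdifferentiableAt_apply ((hV.mlieBracket hW).mdifferentiableAt x)
    rw [e, mvfderiv_const_mul_apply _ (mdifferentiableAt_fun_sub (mdifferentiableAt_fun_sub m1 m2) m3),
      mvfderiv_sub_apply (mdifferentiableAt_fun_sub m1 m2) m3,
      mvfderiv_sub_apply m1 m2]
  -- Without torsion the connection terms pair up into `F([V, W], T)`, which no longer involves the
  -- connection.
  have b {V W T : VField E M} (hV : SmoothVField V) (hW : SmoothVField W) (hT : SmoothVField T) :
      D.F x (nablaVec nabla V W x) (T x) - D.F x (nablaVec nabla W V x) (T x) = 1 / 2 *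
        (mvfderiv 𝓘(ℝ, E) (fun y ↦ mvfderiv 𝓘(ℝ, E) (fun y ↦ D.ell y (T y)) y (W y)) x (V x)
        - mvfderiv 𝓘(ℝ, E) (fun y ↦ mvfderiv 𝓘(ℝ, E) (fun y ↦ D.ell y (T y)) y (V y)) x (W x)
        - mvfderiv 𝓘(ℝ, E) (fun y ↦ D.ell y (mlieBracket 𝓘(ℝ, E) V W y)) x (T x)
        - D.ell x (mlieBracket 𝓘(ℝ, E) (mlieBracket 𝓘(ℝ, E) V W) T x)) := by
    have hVW := (hV.mlieBracket hW).mdifferentiableAt x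
    rw [← mvfderiv_mlieBracket (D.smooth_ell.contMDiff_apply hT) hV hW,
      ← D.F_apply hVW (hT.mdifferentiableAt x),
      h.nablaVec_sub (hV.mdifferentiableAt x) (hW.mdifferentiableAt x), map_sub, sub_apply]
  have b1 := b hX hY hZ
  have b2 := b hY hZ hX
  have b3 := b hZ hX hY
  have j1 := congrArg (D.ell x) jac
  -- Antisymmetry puts the Jacobi identity in the cyclic form `[[V, W], T]` that occurs in `b`.
  rw [mlieBracket_swap_apply (V := X), mlieBracket_swap_apply (V := Y) (W := mlieBracket _ X Z),
    mlieBracket_swap (V := X) (W := Z)] at j1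
  have j2 : mlieBracket 𝓘(ℝ, E) (-mlieBracket 𝓘(ℝ, E) Z X) Y x
      = -mlieBracket 𝓘(ℝ, E) (mlieBracket 𝓘(ℝ, E) Z X) Y x := by
    have := mlieBracket_const_smul_left (𝕜 := ℝ) (I := 𝓘(ℝ, E)) (c := -1) (W := Y)
      ((hZ.mlieBracket hX).mdifferentiableAt x)
    simpa using this
  rw [j2] at j1
  simp only [map_add, map_neg] at j1
  have f1 := D.F_swap (Y x) (nablaVec nabla X Z x)
  have f2 := D.F_swap (Z x) (nablaVec nabla Y X x)
  have f3 := D.F_swap (X x) (nablaVec nabla Z Y x)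
  simp only [nablaCovTensor2]
  rw [d hY hZ hX, d hZ hX hY, d hX hY hZ]
  linear_combination -b1 - b2 - b3 - f1 - f2 - f3 - j1 / 2

/-- The contraction of the curvature with `ℓ`. -/
theorem ell_curvature (h : D.IsMetricHypersurfaceConnection nabla) {X Y Z : VField E M}
    (hX : SmoothVField X) (hY : SmoothVField Y) (hZ : SmoothVField Z) (x : M) :
    D.ell x (curvature nabla X Y Z x) =
      nablaCovTensor2 nabla D.F Z X Y x + nablaCovTensor2 nabla D.ell2U X Y Z x
        - nablaCovTensor2 nabla D.ell2U Y X Z x := by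
  have h1 := h.nabla_F_cyclic hX hY hZ x
  have h2 : nablaCovTensor2 nabla D.F Y X Z x = -nablaCovTensor2 nabla D.F Y Z X x := by
    have e : (fun y ↦ D.F y (X y) (Z y)) = fun y ↦ -1 * D.F y (Z y) (X y) := by
      ext y; rw [F_swap]; ring
    have f1 := D.F_swap (X x) (nablaVec nabla Y Z x)
    have f2 := D.F_swap (nablaVec nabla Y X x) (Z x)
    simp only [nablaCovTensor2]
    rw [e, mvfderiv_const_mul_apply _ (D.mdifferentiableAt_F_apply hZ hX)]
    linear_combination -f1 - f2
  rw [h.ell_curvature_aux hX hY hZ x, h2]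
  linear_combination -h1

/-- The covariant derivative of `n`. -/
theorem nablaVec_n (h : D.IsMetricHypersurfaceConnection nabla) {X : VField E M}
    (hX : SmoothVField X) (x : M) :
    nablaVec nabla X D.n x = (D.s x (X x) - D.n2 x * diff D.ell2 x (X x)) • D.n x
      + D.Pvec x (D.U x (X x) - D.n2 x • D.F x (X x)) := by
  have hXd := hX.mdifferentiableAt x
  have m2 := D.mdifferentiableAt_n2 (x := x)
  have m3 := D.smooth_ell2.mdifferentiable (by simp) x
  have hU := D.U_n (X x)
  have hF := D.F_swap (X x) (D.n x)
  rw [← s_apply] at hF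
  -- Two vectors agree once their pairings with `γ` and `ℓ` do; these are found by differentiating
  -- `γ(n, W) = -n⁽²⁾ℓ(W)` and `ℓ(n) = 1 - n⁽²⁾ℓ⁽²⁾`.
  refine (D.eq_of_ambient (a := 0) (a' := 0) (fun w ↦ ?_) ?_).1
  · obtain ⟨W, hW, rfl⟩ := exists_smoothVField_eq x w
    have hWd := hW.mdifferentiableAt x
    have e : (fun y ↦ D.γ y (D.n y) (W y)) = fun y ↦ -1 * (D.n2 y * D.ell y (W y)) := by
      ext y; rw [γ_n]; ring
    have m1 := D.smooth_ell.mdifferentiableAt_apply hWd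
    have m4 := mdifferentiableAt_fun_mul m2 m1
    have h1 := h.mvfderiv_γ hXd D.mdifferentiableAt_n hWd
    rw [e, mvfderiv_const_mul_apply _ m4, mvfderiv_mul_apply m2 m1, h.mvfderiv_ell hXd hWd, γ_n,
      ell_n] at h1
    simp only [map_add, map_smul, add_apply, smul_apply, sub_apply, smul_eq_mul, γ_n, γ_Pvec,
      diff] at hU ⊢
    rw [hF]
    linear_combination -h1 + 2 * D.ell x (W x) * hU
  · have e : (fun y ↦ D.ell y (D.n y)) = fun y ↦ 1 - D.n2 y * D.ell2 y := by
      ext y; rw [ell_n]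
    have m4 := mdifferentiableAt_fun_mul m2 m3
    have h1 := h.mvfderiv_ell hXd D.mdifferentiableAt_n
    rw [e, mvfderiv_sub_apply mdifferentiableAt_const m4, mvfderiv_mul_apply m2 m3,
      mvfderiv_const_apply] at h1
    simp only [map_add, map_smul, smul_apply, sub_apply, smul_eq_mul, ell_n, ell_Pvec,
      diff] at hU ⊢
    rw [hF] at h1 ⊢
    linear_combination -h1 + 2 * D.ell2 x * hU

end MetricHypersurfaceData.IsMetricHypersurfaceConnection

/-! ### Contractions of the curvature with `n`. -/

namespace MetricHypersurfaceData.IsMetricHypersurfaceConnection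

variable {E : Type*} [NormedAddCommGroup E] [NormedSpace ℝ E] [FiniteDimensional ℝ E]
  {M : Type*} [TopologicalSpace M] [ChartedSpace E M] [IsManifold 𝓘(ℝ, E) ∞ M] [T2Space M]
  {D : MetricHypersurfaceData E M} {nabla : AffineConnection E M}

/-- The contraction of the curvature with `ℓ`, for `X = n`. -/
theorem ell_curvature_n_left (h : D.IsMetricHypersurfaceConnection nabla) {Y Z : VField E M}
    (hY : SmoothVField Y) (hZ : SmoothVField Z) (x : M) :
    D.ell x (curvature nabla D.n Y Z x) =
      nablaOneForm nabla D.s Z Y x + lieCovTensor2 D.n D.ell2U Y Z x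
      + D.P x (D.F x (Y x) - D.ell2 x • D.U x (Y x)) (D.U x (Z x) - D.n2 x • D.F x (Z x))
      + D.n2 x * D.ell2 x * nablaOneForm nabla D.s Y Z x
      - 1 / 2 * nablaOneForm nabla (diff fun y ↦ D.n2 y * D.ell2 y) Y Z x
      + 1 / 2 * diff (fun y ↦ D.n2 y * D.ell2 y) x (Y x) * D.s x (Z x)
      + (D.n2 x * D.ell2 x - 1) *
        ((D.s x (Y x) - 1 / 2 * D.n2 x * diff D.ell2 x (Y x))
            * (D.s x (Z x) - D.n2 x * diff D.ell2 x (Z x))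
          - 1 / 2 * nablaOneForm nabla (fun y ↦ D.n2 y • diff D.ell2 y) Y Z x) := by
  have hn := D.smooth_n
  have hYd := hY.mdifferentiableAt x
  have hZd := hZ.mdifferentiableAt x
  have m2 (y) := D.mdifferentiableAt_n2 (x := y)
  have m3 (y) := D.smooth_ell2.mdifferentiable (by simp) y
  have mA := (contMDiff_mvfderiv_apply D.smooth_ell2 hZ).mdifferentiable (by simp) x
  have mB := (contMDiff_mvfderiv_apply D.smooth_n2 hZ).mdifferentiable (by simp) x
  have mS : MDifferentiableAt 𝓘(ℝ, E) 𝓘(ℝ, ℝ) (fun y ↦ D.s y (Z y)) x :=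
    D.mdifferentiableAt_F_apply hn hZ
  have mnA := mdifferentiableAt_fun_mul (m2 x) mA
  have mlB := mdifferentiableAt_fun_mul (m3 x) mB
  have mnl := mdifferentiableAt_fun_mul (m2 x) (m3 x)
  have mnlS := mdifferentiableAt_fun_mul mnl mS
  have mnlnA := mdifferentiableAt_fun_mul mnl mnA
  have hd (y) (v : TangentSpace 𝓘(ℝ, E) y) : diff (fun y ↦ D.n2 y * D.ell2 y) y v
      = D.n2 y * mvfderiv 𝓘(ℝ, E) D.ell2 y v + D.ell2 y * mvfderiv 𝓘(ℝ, E) D.n2 y v :=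
    mvfderiv_mul_apply (m2 y) (m3 y) v
  have eU : (fun y ↦ D.ell2 y * D.U y (D.n y) (Z y)) = fun y ↦
      (1 / 2 * (D.n2 y * D.ell2 y * (D.n2 y * mvfderiv 𝓘(ℝ, E) D.ell2 y (Z y)))
        + 1 / 2 * (D.ell2 y * mvfderiv 𝓘(ℝ, E) D.n2 y (Z y)))
      - D.n2 y * D.ell2 y * D.s y (Z y) := by
    ext y; rw [U_comm, U_n]; simp only [diff]; ring
  have dU := congrArg (fun f : M → ℝ ↦ mvfderiv 𝓘(ℝ, E) f x (Y x)) eU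
  rw [mvfderiv_sub_apply (mdifferentiableAt_fun_add
      (mdifferentiableAt_fun_mul mdifferentiableAt_const mnlnA)
      (mdifferentiableAt_fun_mul mdifferentiableAt_const mlB)) mnlS,
    mvfderiv_add_apply (mdifferentiableAt_fun_mul mdifferentiableAt_const mnlnA)
      (mdifferentiableAt_fun_mul mdifferentiableAt_const mlB), mvfderiv_const_mul_apply _ mnlnA,
    mvfderiv_const_mul_apply _ mlB, mvfderiv_mul_apply mnl mS, mvfderiv_mul_apply mnl mnA,
    mvfderiv_mul_apply (m3 x) mB, mvfderiv_mul_apply (m2 x) mA,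
    mvfderiv_mul_apply (m2 x) (m3 x)] at dU
  have h1 := h.ell_curvature hn hY hZ x
  have f1 := D.F_swap (nablaVec nabla Z D.n x) (Y x)
  have f2 := D.F_swap (Y x) (D.n x)
  have u1 := D.U_n (Y x)
  have u2 := D.U_n (nablaVec nabla Y Z x)
  rw [D.U_comm] at u2
  have eP := D.P_comm (D.F x (Y x) - D.ell2 x • D.U x (Y x)) (D.U x (Z x) - D.n2 x • D.F x (Z x))
  -- Trading `∇_n(ℓ⁽²⁾U)` for the Lie derivative cancels all terms in `∇_Y n`. What remains is `∇_Z
  -- n`, entering only through `F(Y, ·) - ℓ⁽²⁾U(Y, ·)`; this is the source of the `P` term.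
  have k1 : D.F x (Y x) (nablaVec nabla Z D.n x) - D.ell2 x * D.U x (Y x) (nablaVec nabla Z D.n x)
      = (D.s x (Z x) - D.n2 x * diff D.ell2 x (Z x)) *
        (D.F x (Y x) (D.n x) - D.ell2 x * D.U x (Y x) (D.n x))
        + D.P x (D.U x (Z x) - D.n2 x • D.F x (Z x)) (D.F x (Y x) - D.ell2 x • D.U x (Y x)) := by
    rw [h.nablaVec_n hZ x]
    simp only [map_add, map_smul, smul_eq_mul, P_sub_right, P_smul_right]
    simp only [P]
    ring
  have q := mvfderiv_mul_apply (m2 x) mA (Y x)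
  rw [h1, eP]
  simp only [nablaCovTensor2, nablaOneForm, lieCovTensor2, ell2U_apply, hd,
    h.nablaVec_sub D.mdifferentiableAt_n hYd, h.nablaVec_sub D.mdifferentiableAt_n hZd, map_sub,
    sub_apply, smul_apply, smul_eq_mul, dU]
  rw [mvfderiv_add_apply mnA mlB, mvfderiv_mul_apply (m3 x) mB, mvfderiv_mul_apply (m2 x) mA]
  simp only [← s_apply, diff] at *
  linear_combination k1 - f1 + (D.s x (Z x) - D.n2 x * mvfderiv 𝓘(ℝ, E) D.ell2 x (Z x)) *
    (f2 - D.ell2 x * u1) + D.ell2 x * u2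
    + (D.ell2 x * D.n2 x - 1) / 2 * q

/-- Leibniz rule applied to the formula `U_n`: a derivative of `U` contracted with `n` reduces to
derivatives of `ŝ`, `ℓ⁽²⁾`, `n⁽²⁾` and a term in `∇n`. -/
theorem nablaCovTensor2_U_n {X Y : VField E M}
    (hY : SmoothVField Y) (x : M) :
    nablaCovTensor2 nabla D.U X Y D.n x =
      -diff D.n2 x (X x) * D.s x (Y x) - D.n2 x * nablaOneForm nabla D.s X Y x
      + D.n2 x * diff D.n2 x (X x) * diff D.ell2 x (Y x)
      + 1 / 2 * D.n2 x ^ 2 * nablaOneForm nabla (diff D.ell2) X Y x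
      + 1 / 2 * nablaOneForm nabla (diff D.n2) X Y x - D.U x (Y x) (nablaVec nabla X D.n x) := by
  have m2 := D.mdifferentiableAt_n2 (x := x)
  have mA := (contMDiff_mvfderiv_apply D.smooth_ell2 hY).mdifferentiable (by simp) x
  have mB := (contMDiff_mvfderiv_apply D.smooth_n2 hY).mdifferentiable (by simp) x
  have mS : MDifferentiableAt 𝓘(ℝ, E) 𝓘(ℝ, ℝ) (fun y ↦ D.s y (Y y)) x :=
    D.mdifferentiableAt_F_apply D.smooth_n hY
  have mnS := mdifferentiableAt_fun_mul m2 mS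
  have mnA := mdifferentiableAt_fun_mul m2 mA
  have mnnA := mdifferentiableAt_fun_mul m2 mnA
  have mh := mdifferentiableAt_fun_mul (mdifferentiableAt_const (c := (1 / 2 : ℝ)))
    (mdifferentiableAt_fun_add mnnA mB)
  have e : (fun y ↦ D.U y (Y y) (D.n y)) = fun y ↦
      1 / 2 * (D.n2 y * (D.n2 y * mvfderiv 𝓘(ℝ, E) D.ell2 y (Y y))
        + mvfderiv 𝓘(ℝ, E) D.n2 y (Y y)) - D.n2 y * D.s y (Y y) := by
    ext y; rw [U_n]; simp only [diff]; ring
  simp only [nablaCovTensor2, nablaOneForm, diff]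
  rw [e, mvfderiv_sub_apply mh mnS, mvfderiv_const_mul_apply _ (mdifferentiableAt_fun_add mnnA mB),
    mvfderiv_add_apply mnnA mB, mvfderiv_mul_apply m2 mnA, mvfderiv_mul_apply m2 mA,
    mvfderiv_mul_apply m2 mS, U_n]
  simp only [diff]
  ring

theorem nablaCovTensor2_F_n {X Y : VField E M}
    (hY : SmoothVField Y) (x : M) :
    nablaCovTensor2 nabla D.F X Y D.n x =
      -nablaOneForm nabla D.s X Y x - D.F x (Y x) (nablaVec nabla X D.n x) := by
  have mS : MDifferentiableAt 𝓘(ℝ, E) 𝓘(ℝ, ℝ) (fun y ↦ D.s y (Y y)) x :=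
    D.mdifferentiableAt_F_apply D.smooth_n hY
  have e : (fun y ↦ D.F y (Y y) (D.n y)) = fun y ↦ -1 * D.s y (Y y) := by
    ext y; rw [F_swap, s_apply]; ring
  simp only [nablaCovTensor2, nablaOneForm]
  rw [e, mvfderiv_const_mul_apply _ mS, D.F_swap _ (D.n x), ← s_apply]
  ring

/-- The contraction of the curvature with `ℓ`, evaluated on `n`. -/
theorem ell_curvature_n (h : D.IsMetricHypersurfaceConnection nabla) {X Y : VField E M}
    (hX : SmoothVField X) (hY : SmoothVField Y) (x : M) :
    D.ell x (curvature nabla X Y D.n x) =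
      (1 - D.ell2 x * D.n2 x) *
        (nablaOneForm nabla D.s X Y x - nablaOneForm nabla D.s Y X x
          + (D.P x (leftSlot D.F x (X x)) (D.U x (Y x))
              - D.P x (leftSlot D.F x (Y x)) (D.U x (X x)))
          + 1 / 2 * (diff D.ell2 x (X x) * diff D.n2 x (Y x)
              - diff D.ell2 x (Y x) * diff D.n2 x (X x)))
      + D.ell2 x * (1 / 2 *
          (D.s x (X x) * (diff D.n2 x (Y x) + D.n2 x ^ 2 * diff D.ell2 x (Y x))
            - D.s x (Y x) * (diff D.n2 x (X x) + D.n2 x ^ 2 * diff D.ell2 x (X x)))) := by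
  have hn := D.smooth_n
  -- The Hessians of `ℓ⁽²⁾` and `n⁽²⁾` drop out of the antisymmetrization in `X` and `Y`.
  have n1 := nablaOneForm_diff_comm h.torsion_free D.smooth_ell2 hX hY x
  have n2 := nablaOneForm_diff_comm h.torsion_free D.smooth_n2 hX hY x
  have p1 := D.P_comm (D.U x (X x)) (D.F x (Y x))
  have p2 := D.P_comm (D.U x (Y x)) (D.F x (X x))
  have p3 := D.P_comm (D.U x (X x)) (D.U x (Y x))
  have p4 := D.P_comm (D.F x (X x)) (D.F x (Y x))
  have e (α β : TangentSpace 𝓘(ℝ, E) x →L[ℝ] ℝ) : β (D.Pvec x α) = D.P x α β := rfl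
  have en (α β : TangentSpace 𝓘(ℝ, E) x →L[ℝ] ℝ) : D.P x (-α) β = -D.P x α β := by
    rw [← neg_one_smul ℝ α, P_smul_left, neg_one_mul]
  have f1 := D.F_swap (X x) (D.n x)
  have f2 := D.F_swap (Y x) (D.n x)
  -- The form that precedes cyclicity is the useful one: it keeps `n` in the last slot of every
  -- derivative of `F` and `U`.
  rw [h.ell_curvature_aux hX hY hn, nablaCovTensor2_ell2U hY hn, nablaCovTensor2_ell2U hX hn,
    nablaCovTensor2_F_n hY, nablaCovTensor2_F_n hX, nablaCovTensor2_U_n hY, nablaCovTensor2_U_n hX, h.nablaVec_n hX,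
    h.nablaVec_n hY, leftSlot_F, leftSlot_F, en, en]
  simp only [map_add, map_smul, smul_eq_mul, e, P_sub_left, P_smul_left, U_n] at f1 f2 ⊢
  rw [f1, f2, ← s_apply, ← s_apply, n1, n2, p1, p2, p3, p4]
  ring

/-- The contraction of the curvature with `ℓ`, evaluated on `n`, for `X = n`. -/
theorem ell_curvature_n_n (h : D.IsMetricHypersurfaceConnection nabla) {Y : VField E M}
    (hY : SmoothVField Y) (x : M) :
    D.ell x (curvature nabla D.n Y D.n x) =
      (1 - D.ell2 x * D.n2 x) *
        (lieOneForm D.n D.s Y x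
          - D.P x (D.s x) (D.U x (Y x) + D.n2 x • D.F x (Y x))
          + 1 / 2 * D.P x (D.F x (Y x)) (diff D.n2 x + D.n2 x ^ 2 • diff D.ell2 x))
      + 1 / 2 * diff D.ell2 x (D.n x) *
        ((1 - D.ell2 x * D.n2 x) * diff D.n2 x (Y x) - D.ell2 x * D.n2 x ^ 2 * D.s x (Y x))
      - 1 / 2 * diff D.n2 x (D.n x) *
        ((1 - D.n2 x * D.ell2 x) * diff D.ell2 x (Y x) + D.ell2 x * D.s x (Y x)) := by
  have eU : D.U x (D.n x) = -D.n2 x • D.s x + (1 / 2 * D.n2 x ^ 2) • diff D.ell2 x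
      + (1 / 2 : ℝ) • diff D.n2 x := by
    ext v
    rw [U_comm, U_n]
    simp
  have en (α β : TangentSpace 𝓘(ℝ, E) x →L[ℝ] ℝ) : D.P x (-α) β = -D.P x α β := by
    rw [← neg_one_smul ℝ α, P_smul_left, neg_one_mul]
  have hs : D.F x (D.n x) = D.s x := rfl
  have p1 := D.P_comm (D.F x (Y x)) (D.s x)
  rw [h.ell_curvature_n D.smooth_n hY, leftSlot_F, leftSlot_F, en, en, eU, hs]
  -- Since `ŝ(n) = 0` and torsion vanishes, the antisymmetrized derivative of `ŝ` contracted with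
  -- `n` is `£_n ŝ`.
  simp only [nablaOneForm, lieOneForm, mvfderiv_const_apply, s_n, P_add_right, P_smul_right,
    h.nablaVec_sub D.mdifferentiableAt_n (hY.mdifferentiableAt x), map_sub]
  rw [p1]
  ring

/-- The curvature evaluated on `n`. -/
theorem curvature_n (h : D.IsMetricHypersurfaceConnection nabla) {X Y : VField E M}
    (hX : SmoothVField X) (hY : SmoothVField Y) {α : OneForm E M} (hα : SmoothOneForm α) (x : M) :
    α x (curvature nabla X Y D.n x) =
      α x (D.n x) *
        (nablaOneForm nabla D.s X Y x - nablaOneForm nabla D.s Y X x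
          + 1 / 2 * (diff D.ell2 x (X x) * diff D.n2 x (Y x)
              - diff D.ell2 x (Y x) * diff D.n2 x (X x))
          + (D.P x (leftSlot D.F x (X x)) (D.U x (Y x))
              - D.P x (leftSlot D.F x (Y x)) (D.U x (X x))))
      + (nablaCovTensor2 nabla D.U X Y (fun y ↦ D.Pvec y (α y)) x
          - nablaCovTensor2 nabla D.U Y X (fun y ↦ D.Pvec y (α y)) x
          + D.n2 x * nablaCovTensor2 nabla D.F (fun y ↦ D.Pvec y (α y)) X Y x
          + (D.U x (D.Pvec x (α x)) (X x)
                * (D.s x (Y x) - D.n2 x * diff D.ell2 x (Y x))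
              - D.U x (D.Pvec x (α x)) (Y x)
                * (D.s x (X x) - D.n2 x * diff D.ell2 x (X x)))
          + 1 / 2 *
            (D.F x (D.Pvec x (α x)) (X x)
                * (2 * D.n2 x * D.s x (Y x) - diff D.n2 x (Y x)
                  - D.n2 x ^ 2 * diff D.ell2 x (Y x))
              - D.F x (D.Pvec x (α x)) (Y x)
                * (2 * D.n2 x * D.s x (X x) - diff D.n2 x (X x)
                  - D.n2 x ^ 2 * diff D.ell2 x (X x)))) := by
  have hn := D.smooth_n
  have hW := D.smooth_Pvec hα
  -- With `W = P(α, ·)`, `h1` splits `α(R(X, Y)n)` into `γ(R(X, Y)n, W)` and `α(n)ℓ(R(X, Y)n)`. The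
  -- Ricci identity `h2` gives the former up to `γ(n, R(X, Y)W) = -n⁽²⁾ℓ(R(X, Y)W)`, which `h3`
  -- evaluates; `h4` gives the latter.
  have h1 := D.γ_Pvec (α x) (curvature nabla X Y D.n x)
  have h2 := h.γ_curvature hX hY hn hW x
  have h3 := h.ell_curvature hX hY hW x
  have h4 := h.ell_curvature_n hX hY x
  have n1 := nablaOneForm_diff_comm h.torsion_free D.smooth_ell2 hX hY x
  have n2 := nablaOneForm_diff_comm h.torsion_free D.smooth_n2 hX hY x
  have p3 := D.P_comm (D.U x (X x)) (D.U x (Y x))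
  have e (α β : TangentSpace 𝓘(ℝ, E) x →L[ℝ] ℝ) : β (D.Pvec x α) = D.P x α β := rfl
  have en (α β : TangentSpace 𝓘(ℝ, E) x →L[ℝ] ℝ) : D.P x (-α) β = -D.P x α β := by
    rw [← neg_one_smul ℝ α, P_smul_left, neg_one_mul]
  have f1 := D.F_swap (X x) (D.n x)
  have f2 := D.F_swap (Y x) (D.n x)
  have f3 := D.F_swap (X x) (D.Pvec x (α x))
  have f4 := D.F_swap (Y x) (D.Pvec x (α x))
  have u3 := D.U_comm (X x) (D.Pvec x (α x))
  have u4 := D.U_comm (Y x) (D.Pvec x (α x))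
  rw [← s_apply] at f1 f2
  rw [D.symm_γ] at h1
  rw [γ_n, h3, nablaCovTensor2_ell2U hY hW, nablaCovTensor2_ell2U hX hW, ell_Pvec, ell_n,
    nablaCovTensor2_U_n hY, nablaCovTensor2_U_n hX, h.nablaVec_n hX,
    h.nablaVec_n hY] at h2
  rw [leftSlot_F, leftSlot_F, en, en] at h4 ⊢
  simp only [map_add, map_smul, smul_eq_mul, U_n] at h2
  rw [e (D.U x (X x) - D.n2 x • D.F x (X x)), e (D.U x (Y x) - D.n2 x • D.F x (Y x))] at h2
  simp only [P_sub_left, P_smul_left] at h2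
  rw [f1, f2, f3, f4, u3, u4, n1, n2, p3] at h2
  linear_combination -h1 + h2 + α x (D.n x) * h4

end MetricHypersurfaceData.IsMetricHypersurfaceConnection

/-! ### Existence of the metric hypersurface connection. -/

namespace MetricHypersurfaceData

variable {E : Type*} [NormedAddCommGroup E] [NormedSpace ℝ E] [FiniteDimensional ℝ E]
  {M : Type*} [TopologicalSpace M] [ChartedSpace E M] [IsManifold 𝓘(ℝ, E) ∞ M]
  (D : MetricHypersurfaceData E M) {x : M}

/-- The Koszul expression of `γ`, with value `γ(∇_X Z, W)` for the Levi-Civita connection. -/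
noncomputable def koszul (Z X W : VField E M) (x : M) : ℝ :=
  1 / 2 * (lieCovTensor2 Z D.γ X W x + extDerivOneForm (fun y ↦ D.γ y (Z y)) X W x)

/-- The exterior derivative part is expanded by hand because `γ(Z, ·)` need not be a smooth
one-form: `Z` is differentiable only at `x`. -/
theorem tensorial_koszul_left {Z : VField E M} (hZ : MDiffAt (T% Z) x) {W : VField E M}
    (hW : MDiffAt (T% W) x) : TensorialAt 𝓘(ℝ, E) E (fun X : VField E M ↦ D.koszul Z X W x) x := by
  have t := tensorial_lie_left Z D.smooth_γ x W hW
  constructor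
  · intro f X hf hX
    have h := D.smooth_γ.mdifferentiableAt_apply hZ hX
    have e : (fun y ↦ D.γ y (Z y) ((f • X) y)) = fun y ↦ f y * D.γ y (Z y) (X y) := by
      ext y; simp
    simp only [koszul, t.smul hf hX]
    simp only [extDerivOneForm, e, mvfderiv_fun_mul hf h, mlieBracket_smul_left hf hX]
    simp
    ring
  · intro X X' hX hX'
    have h := D.smooth_γ.mdifferentiableAt_apply hZ hX
    have h' := D.smooth_γ.mdifferentiableAt_apply hZ hX'
    have e : (fun y ↦ D.γ y (Z y) ((X + X') y)) = fun y ↦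
        D.γ y (Z y) (X y) + D.γ y (Z y) (X' y) := by ext y; simp
    simp only [koszul, t.add hX hX']
    simp only [extDerivOneForm, e, mvfderiv_fun_add h h', mlieBracket_add_left hX hX']
    simp
    ring

theorem tensorial_koszul_right {Z : VField E M} (hZ : MDiffAt (T% Z) x) {X : VField E M}
    (hX : MDiffAt (T% X) x) : TensorialAt 𝓘(ℝ, E) E (fun W : VField E M ↦ D.koszul Z X W x) x := by
  have t := tensorial_lie_right Z D.smooth_γ x X hX
  constructor
  · intro f W hf hW
    have h := D.smooth_γ.mdifferentiableAt_apply hZ hW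
    have e : (fun y ↦ D.γ y (Z y) ((f • W) y)) = fun y ↦ f y * D.γ y (Z y) (W y) := by
      ext y; simp
    simp only [koszul, t.smul hf hW]
    simp only [extDerivOneForm, e, mvfderiv_fun_mul hf h, mlieBracket_smul_right hf hW]
    simp
    ring
  · intro W W' hW hW'
    have h := D.smooth_γ.mdifferentiableAt_apply hZ hW
    have h' := D.smooth_γ.mdifferentiableAt_apply hZ hW'
    have e : (fun y ↦ D.γ y (Z y) ((W + W') y)) = fun y ↦
        D.γ y (Z y) (W y) + D.γ y (Z y) (W' y) := by ext y; simp
    simp only [koszul, t.add hW hW']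
    simp only [extDerivOneForm, e, mvfderiv_fun_add h h', mlieBracket_add_right hW hW']
    simp
    ring

/-- The Koszul expression as a bilinear form in its last two arguments. -/
noncomputable def koszulTensor (Z : VField E M) (x : M) (hZ : MDiffAt (T% Z) x) :
    TangentSpace 𝓘(ℝ, E) x →L[ℝ] TangentSpace 𝓘(ℝ, E) x →L[ℝ] ℝ :=
  TensorialAt.mkHom₂ (fun X W ↦ D.koszul Z X W x) x
    (fun _ hW ↦ D.tensorial_koszul_left hZ hW) (fun _ hX ↦ D.tensorial_koszul_right hZ hX)

theorem koszulTensor_apply {Z X W : VField E M} (hZ : MDiffAt (T% Z) x) (hX : MDiffAt (T% X) x)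
    (hW : MDiffAt (T% W) x) : D.koszulTensor Z x hZ (X x) (W x) = D.koszul Z X W x :=
  TensorialAt.mkHom₂_apply _ _ hX hW

open Classical in
/-- The metric hypersurface connection, as an operator on vector fields: `(∇_X Z, -U(X, Z))` is
raised from the Koszul expression of `γ` and the covector `d(ℓ(Z)) - F(·, Z)`. -/
noncomputable def connectionFun (Z : VField E M) (x : M) :
    TangentSpace 𝓘(ℝ, E) x →L[ℝ] TangentSpace 𝓘(ℝ, E) x :=
  have : T2Space (TangentSpace 𝓘(ℝ, E) x) := inferInstanceAs (T2Space E)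
  if hZ : MDiffAt (T% Z) x then
    LinearMap.toContinuousLinearMap
      { toFun := fun v ↦ (D.sharp x (pairDual x (D.koszulTensor Z x hZ v)
          (mvfderiv 𝓘(ℝ, E) (fun y ↦ D.ell y (Z y)) x v - D.F x v (Z x)))).1
        map_add' := fun v w ↦ by
          rw [← Prod.fst_add, ← map_add]
          congr 2
          ext <;> simp [pairDual]
          ring
        map_smul' := fun c v ↦ by
          rw [RingHom.id_apply, ← Prod.smul_fst, ← map_smul]
          congr 2
          ext <;> simp [pairDual]
          ring }
  -- An irrelevant value: the laws of a covariant derivative concern only sections differentiable at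
  -- the point.
  else 0

theorem sharp_pairDual_snd_eq (α : TangentSpace 𝓘(ℝ, E) x →L[ℝ] ℝ) (b : ℝ) :
    (D.sharp x (pairDual x α b)).2 = α (D.n x) + b * D.n2 x := by
  have h : pairDual x α b = pairDual x α 0 + b • pairDual x 0 1 := by ext <;> simp [pairDual]
  rw [h, map_add, map_smul, Prod.snd_add, sharp_pairDual_snd, Prod.smul_snd, smul_eq_mul]
  rfl

variable [T2Space M]

/-- The consistency condition of the construction: the left side is the scalar component of the
raised covector. It equals `-U(X, Z)` because `γ(·, n) = -n⁽²⁾ℓ` turns the Koszul expression into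
`£_n γ` and derivatives of `n⁽²⁾ℓ`. -/
theorem koszul_n {Z X : VField E M} (hZ : MDiffAt (T% Z) x) (hX : MDiffAt (T% X) x) :
    D.koszul Z X D.n x + (mvfderiv 𝓘(ℝ, E) (fun y ↦ D.ell y (Z y)) x (X x) - D.F x (X x) (Z x))
      * D.n2 x = -D.U x (X x) (Z x) := by
  have e (V : VField E M) : (fun y ↦ D.γ y (V y) (D.n y)) =
      fun y ↦ -1 * (D.n2 y * D.ell y (V y)) := by
    ext y; rw [D.symm_γ, γ_n]; ring
  have eZ : (fun y ↦ D.γ y (Z y) (X y)) = fun y ↦ D.γ y (X y) (Z y) := by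
    ext y; exact D.symm_γ y _ _
  have m2 := D.mdifferentiableAt_n2 (x := x)
  have mX := D.smooth_ell.mdifferentiableAt_apply hX
  have mZ := D.smooth_ell.mdifferentiableAt_apply hZ
  have mnX := mdifferentiableAt_fun_mul m2 mX
  have mnZ := mdifferentiableAt_fun_mul m2 mZ
  have b1 : D.γ x (Z x) (mlieBracket 𝓘(ℝ, E) X D.n x)
      = -D.γ x (mlieBracket 𝓘(ℝ, E) D.n X x) (Z x) := by
    rw [mlieBracket_swap_apply, map_neg, D.symm_γ]
  have b2 : D.γ x (X x) (mlieBracket 𝓘(ℝ, E) Z D.n x)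
      = -D.γ x (X x) (mlieBracket 𝓘(ℝ, E) D.n Z x) := by
    rw [mlieBracket_swap_apply, map_neg]
  have b3 : D.ell x (mlieBracket 𝓘(ℝ, E) Z X x) = -D.ell x (mlieBracket 𝓘(ℝ, E) X Z x) := by
    rw [mlieBracket_swap_apply, map_neg]
  rw [D.F_apply hX hZ, D.U_apply hX hZ]
  simp only [koszul, lieCovTensor2, extDerivOneForm, diff]
  rw [e, e, mvfderiv_const_mul_apply _ mnX, mvfderiv_const_mul_apply _ mnZ,
    mvfderiv_mul_apply m2 mX, mvfderiv_mul_apply m2 mZ, eZ, b1, b2,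
    D.symm_γ x (mlieBracket _ Z X x) (D.n x), γ_n, b3]
  ring

theorem connectionFun_spec {Z X : VField E M} (hZ : MDiffAt (T% Z) x) (hX : MDiffAt (T% X) x) :
    (∀ W : VField E M, MDiffAt (T% W) x → D.γ x (D.connectionFun Z x (X x)) (W x) =
      D.koszul Z X W x + D.U x (X x) (Z x) * D.ell x (W x)) ∧
    D.ell x (D.connectionFun Z x (X x)) = mvfderiv 𝓘(ℝ, E) (fun y ↦ D.ell y (Z y)) x (X x)
      - D.F x (X x) (Z x) + D.ell2 x * D.U x (X x) (Z x) := by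
  set Φ := pairDual x (D.koszulTensor Z x hZ (X x))
    (mvfderiv 𝓘(ℝ, E) (fun y ↦ D.ell y (Z y)) x (X x) - D.F x (X x) (Z x)) with hΦ
  have e : D.connectionFun Z x (X x) = (D.sharp x Φ).1 := by
    simp only [connectionFun, dif_pos hZ]
    rfl
  have e2 : (D.sharp x Φ).2 = -D.U x (X x) (Z x) := by
    rw [sharp_pairDual_snd_eq, D.koszulTensor_apply hZ hX D.mdifferentiableAt_n, D.koszul_n hZ hX]
  rw [e]
  refine ⟨fun W hW ↦ ?_, ?_⟩
  · have h := D.γ_sharp Φ (W x)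
    rw [e2, hΦ, pairDual_apply, D.koszulTensor_apply hZ hX hW, mul_zero, add_zero] at h
    linear_combination h
  · have h := D.ell_sharp Φ
    rw [e2, hΦ, pairDual_apply, map_zero, zero_add, mul_one] at h
    linear_combination h

/-- A connection vector is determined by the values of `γ` and `ℓ` on it, corrected by `U`. -/
theorem connectionFun_eq {Z X : VField E M} (hZ : MDiffAt (T% Z) x) (hX : MDiffAt (T% X) x)
    {v : TangentSpace 𝓘(ℝ, E) x}
    (h : ∀ W : VField E M, SmoothVField W →
      D.γ x v (W x) = D.koszul Z X W x + D.U x (X x) (Z x) * D.ell x (W x))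
    (h' : D.ell x v = mvfderiv 𝓘(ℝ, E) (fun y ↦ D.ell y (Z y)) x (X x)
      - D.F x (X x) (Z x) + D.ell2 x * D.U x (X x) (Z x)) : D.connectionFun Z x (X x) = v := by
  obtain ⟨h1, h2⟩ := D.connectionFun_spec hZ hX
  refine (D.eq_of_ambient (a := 0) (a' := 0) (fun w ↦ ?_) (by rw [h2, h'])).1
  obtain ⟨W, hW, rfl⟩ := exists_smoothVField_eq x w
  rw [h1 W (hW.mdifferentiableAt x), h W hW]

/-- By `connectionFun_eq` it suffices that the candidate has the right pairings with `γ` and `ℓ`.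
For the Leibniz rule, replacing `Z` by `fZ` adds `X(f)γ(Z, W)` to `f` times the Koszul expression,
as the terms in `W(f)` cancel. -/
theorem isCovariantDerivativeOn_connectionFun :
    IsCovariantDerivativeOn E (I := 𝓘(ℝ, E)) (V := fun x : M ↦ TangentSpace 𝓘(ℝ, E) x)
      D.connectionFun where
  add {Z Z' x} hZ hZ' _ := by
    ext v
    obtain ⟨X, hX, rfl⟩ := exists_smoothVField_eq x v
    have hXd := hX.mdifferentiableAt x
    obtain ⟨h1, h2⟩ := D.connectionFun_spec hZ hXd
    obtain ⟨h1', h2'⟩ := D.connectionFun_spec hZ' hXd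
    refine D.connectionFun_eq (mdifferentiableAt_add_section hZ hZ') hXd (fun W hW ↦ ?_) ?_
    · have hWd := hW.mdifferentiableAt x
      have mX := D.smooth_γ.mdifferentiableAt_apply hZ hXd
      have mX' := D.smooth_γ.mdifferentiableAt_apply hZ' hXd
      have mW := D.smooth_γ.mdifferentiableAt_apply hZ hWd
      have mW' := D.smooth_γ.mdifferentiableAt_apply hZ' hWd
      simp only [add_apply, map_add, h1 W hWd, h1' W hWd, koszul, lieCovTensor2, extDerivOneForm,
        Pi.add_apply]
      rw [mvfderiv_add_apply mX mX', mvfderiv_add_apply mW mW', mlieBracket_add_left hZ hZ',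
        mlieBracket_add_left hZ hZ']
      simp only [map_add, add_apply]
      ring
    · simp only [add_apply, map_add, h2, h2', Pi.add_apply]
      rw [mvfderiv_add_apply (D.smooth_ell.mdifferentiableAt_apply hZ)
        (D.smooth_ell.mdifferentiableAt_apply hZ')]
      ring
  leibniz {Z f x} hZ hf _ := by
    ext v
    obtain ⟨X, hX, rfl⟩ := exists_smoothVField_eq x v
    have hXd := hX.mdifferentiableAt x
    obtain ⟨h1, h2⟩ := D.connectionFun_spec hZ hXd
    refine D.connectionFun_eq (hf.smul_section hZ) hXd (fun W hW ↦ ?_) ?_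
    · have hWd := hW.mdifferentiableAt x
      have mX := D.smooth_γ.mdifferentiableAt_apply hZ hXd
      have mW := D.smooth_γ.mdifferentiableAt_apply hZ hWd
      simp only [add_apply, map_add, smul_apply, map_smul, smul_eq_mul, h1 W hWd, koszul,
        lieCovTensor2, extDerivOneForm, Pi.smul_apply', ContinuousLinearMap.smulRight_apply]
      rw [mvfderiv_mul_apply hf mX, mvfderiv_mul_apply hf mW, mlieBracket_smul_left hf hZ,
        mlieBracket_smul_left hf hZ]
      simp only [map_add, map_smul, add_apply, smul_apply, smul_eq_mul, D.symm_γ x (X x) (Z x)]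
      ring
    · simp only [add_apply, map_add, smul_apply, map_smul, smul_eq_mul, h2, Pi.smul_apply',
        ContinuousLinearMap.smulRight_apply]
      rw [mvfderiv_mul_apply hf (D.smooth_ell.mdifferentiableAt_apply hZ)]
      ring

/-- The metric hypersurface connection. -/
noncomputable def connection : AffineConnection E M where
  toFun := D.connectionFun
  isCovariantDerivativeOnUniv := D.isCovariantDerivativeOn_connectionFun

theorem smooth_connectionFun {Z X : VField E M} (hZ : SmoothVField Z) (hX : SmoothVField X) :
    SmoothVField fun x ↦ D.connectionFun Z x (X x) := by
  have s {V W : VField E M} (hV : SmoothVField V) (hW : SmoothVField W) :=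
    D.smooth_γ.contMDiff_apply hV hW
  -- With scalar component `-U(X, Z)` the image under the ambient form is the Koszul expression and
  -- `X(ℓ(Z)) - F(X, Z)`, both smooth.
  refine (D.smooth_of_ambient (a := fun x ↦ -1 * D.U x (X x) (Z x)) (fun W hW ↦ ?_) ?_).1
  · have : ContMDiff 𝓘(ℝ, E) 𝓘(ℝ, ℝ) ∞ (D.koszul Z X W) :=
      contMDiff_const.mul ((((contMDiff_mvfderiv_apply (s hX hW) hZ).sub
        (s (hZ.mlieBracket hX) hW)).sub (s hX (hZ.mlieBracket hW))).add
        (((contMDiff_mvfderiv_apply (s hZ hW) hX).sub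
        (contMDiff_mvfderiv_apply (s hZ hX) hW)).sub (s hZ (hX.mlieBracket hW))))
    refine this.congr fun x ↦ ?_
    rw [(D.connectionFun_spec (hZ.mdifferentiableAt x) (hX.mdifferentiableAt x)).1 W
      (hW.mdifferentiableAt x)]
    ring
  · refine ((contMDiff_mvfderiv_apply (D.smooth_ell.contMDiff_apply hZ) hX).sub
      (D.contMDiff_F_apply hX hZ)).congr fun x ↦ ?_
    rw [(D.connectionFun_spec (hZ.mdifferentiableAt x) (hX.mdifferentiableAt x)).2]
    ring

theorem isMetricHypersurfaceConnection_connection :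
    D.IsMetricHypersurfaceConnection D.connection where
  smooth := ⟨⟨fun {Z} hZ ↦ contMDiffOn_univ.2 <| contMDiff_endomorphism_of_apply fun X hX ↦
    D.smooth_connectionFun (contMDiffOn_univ.1 (by simpa using hZ)) hX⟩⟩
  torsion_free := by
    have : CompleteSpace E := FiniteDimensional.complete ℝ E
    refine (CovariantDerivative.torsion_eq_zero_iff _).2 fun {X Z x} hX hZ ↦ ?_
    -- In the form `∇_X Z = [X, Z] + ∇_Z X`, the claim follows from the pairings that characterize
    -- `∇_X Z`.
    rw [sub_eq_iff_eq_add]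
    refine D.connectionFun_eq hZ hX (fun W hW ↦ ?_) ?_
    · have hWd := hW.mdifferentiableAt x
      rw [map_add, add_apply]
      refine (congrArg _ ((D.connectionFun_spec hX hZ).1 W hWd)).trans ?_
      have b1 : mlieBracket 𝓘(ℝ, E) Z X x = -mlieBracket 𝓘(ℝ, E) X Z x :=
        mlieBracket_swap_apply
      have eZ : (fun y ↦ D.γ y (Z y) (X y)) = fun y ↦ D.γ y (X y) (Z y) := by
        ext y; exact D.symm_γ y _ _
      simp only [koszul, lieCovTensor2, extDerivOneForm]
      rw [b1, eZ, D.U_comm (Z x)]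
      simp only [map_neg, neg_apply]
      ring
    · rw [map_add]
      refine (congrArg _ (D.connectionFun_spec hX hZ).2).trans ?_
      rw [D.F_apply hX hZ, D.F_apply hZ hX, D.U_comm (Z x), mlieBracket_swap_apply (V := Z),
        map_neg]
      ring
  nabla_γ x X Z W hX hZ hW := by
    -- In the sum of the Koszul expressions for `(Z, X, W)` and `(W, X, Z)` everything cancels
    -- except `X(γ(Z, W))`.
    have h1 := (D.connectionFun_spec hZ hX).1 W hW
    have h2 := (D.connectionFun_spec hW hX).1 Z hZ
    rw [D.symm_γ] at h2
    have b (V T : VField E M) : mlieBracket 𝓘(ℝ, E) V T x = -mlieBracket 𝓘(ℝ, E) T V x :=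
      mlieBracket_swap_apply
    have e (V T : VField E M) : (fun y ↦ D.γ y (V y) (T y)) = fun y ↦ D.γ y (T y) (V y) := by
      ext y; exact D.symm_γ y _ _
    simp only [koszul, lieCovTensor2, extDerivOneForm] at h1 h2
    rw [e W Z, e X Z, b W X, b W Z, D.symm_γ x _ (Z x), D.symm_γ x (W x)] at h2
    rw [e X W, b Z X] at h1
    simp only [map_neg, neg_apply] at h1 h2
    simp only [nablaCovTensor2, nablaVec]
    change _ - D.γ x (D.connectionFun Z x (X x)) (W x) - D.γ x (Z x) (D.connectionFun W x (X x)) = _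
    linear_combination -h1 - h2
  nabla_ell x X Z hX hZ := by
    have h1 := (D.connectionFun_spec hZ hX).2
    have h2 := (D.connectionFun_spec hX hZ).2
    rw [D.F_swap, D.U_comm] at h2
    simp only [nablaOneForm, nablaVec]
    change _ - D.ell x (D.connectionFun Z x (X x))
      + (_ - D.ell x (D.connectionFun X x (Z x))) = _
    linear_combination -h1 - h2

end MetricHypersurfaceData

theorem mainTheorem11 {E : Type*} [NormedAddCommGroup E] [NormedSpace ℝ E] [FiniteDimensional ℝ E]
    {M : Type*} [TopologicalSpace M] [T2Space M] [SecondCountableTopology M]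
    [ChartedSpace E M] [IsManifold 𝓘(ℝ, E) ∞ M] (D : MetricHypersurfaceData E M) :
    (∃ nabla : AffineConnection E M, D.IsMetricHypersurfaceConnection nabla) ∧
    ∀ nabla : AffineConnection E M, D.IsMetricHypersurfaceConnection nabla →
    -- the indices `a`, `c`, `b` are contracted with `Z`, `X`, `Y`
    ∀ X Y Z : VField E M, SmoothVField X → SmoothVField Y → SmoothVField Z → ∀ x : M,
    -- first identity
    D.ell x (curvature nabla X Y Z x) =
        nablaCovTensor2 nabla D.F Z X Y x + nablaCovTensor2 nabla D.ell2U X Y Z x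
          - nablaCovTensor2 nabla D.ell2U Y X Z x ∧
    -- second identity
    D.ell x (curvature nabla D.n Y Z x) =
        nablaOneForm nabla D.s Z Y x + lieCovTensor2 D.n D.ell2U Y Z x
        + D.P x (D.F x (Y x) - D.ell2 x • D.U x (Y x)) (D.U x (Z x) - D.n2 x • D.F x (Z x))
        + D.n2 x * D.ell2 x * nablaOneForm nabla D.s Y Z x
        - 1 / 2 * nablaOneForm nabla (diff fun y ↦ D.n2 y * D.ell2 y) Y Z x
        + 1 / 2 * diff (fun y ↦ D.n2 y * D.ell2 y) x (Y x) * D.s x (Z x)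
        + (D.n2 x * D.ell2 x - 1) *
          ((D.s x (Y x) - 1 / 2 * D.n2 x * diff D.ell2 x (Y x))
              * (D.s x (Z x) - D.n2 x * diff D.ell2 x (Z x))
            - 1 / 2 * nablaOneForm nabla (fun y ↦ D.n2 y • diff D.ell2 y) Y Z x) ∧
    -- third identity: the free index `d` is contracted with an arbitrary one-form `α`
    (∀ α : OneForm E M, SmoothOneForm α →
      α x (curvature nabla X Y D.n x) =
        α x (D.n x) *
          (nablaOneForm nabla D.s X Y x - nablaOneForm nabla D.s Y X x
            + 1 / 2 * (diff D.ell2 x (X x) * diff D.n2 x (Y x)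
                - diff D.ell2 x (Y x) * diff D.n2 x (X x))
            + (D.P x (leftSlot D.F x (X x)) (D.U x (Y x))
                - D.P x (leftSlot D.F x (Y x)) (D.U x (X x))))
        + (nablaCovTensor2 nabla D.U X Y (fun y ↦ D.Pvec y (α y)) x
            - nablaCovTensor2 nabla D.U Y X (fun y ↦ D.Pvec y (α y)) x
            + D.n2 x * nablaCovTensor2 nabla D.F (fun y ↦ D.Pvec y (α y)) X Y x
            + (D.U x (D.Pvec x (α x)) (X x)
                  * (D.s x (Y x) - D.n2 x * diff D.ell2 x (Y x))
                - D.U x (D.Pvec x (α x)) (Y x)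
                  * (D.s x (X x) - D.n2 x * diff D.ell2 x (X x)))
            + 1 / 2 *
              (D.F x (D.Pvec x (α x)) (X x)
                  * (2 * D.n2 x * D.s x (Y x) - diff D.n2 x (Y x)
                    - D.n2 x ^ 2 * diff D.ell2 x (Y x))
                - D.F x (D.Pvec x (α x)) (Y x)
                  * (2 * D.n2 x * D.s x (X x) - diff D.n2 x (X x)
                    - D.n2 x ^ 2 * diff D.ell2 x (X x))))) ∧
    -- fourth identity
    D.ell x (curvature nabla X Y D.n x) =
        (1 - D.ell2 x * D.n2 x) *
          (nablaOneForm nabla D.s X Y x - nablaOneForm nabla D.s Y X x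
            + (D.P x (leftSlot D.F x (X x)) (D.U x (Y x))
                - D.P x (leftSlot D.F x (Y x)) (D.U x (X x)))
            + 1 / 2 * (diff D.ell2 x (X x) * diff D.n2 x (Y x)
                - diff D.ell2 x (Y x) * diff D.n2 x (X x)))
        + D.ell2 x * (1 / 2 *
            (D.s x (X x) * (diff D.n2 x (Y x) + D.n2 x ^ 2 * diff D.ell2 x (Y x))
              - D.s x (Y x) * (diff D.n2 x (X x) + D.n2 x ^ 2 * diff D.ell2 x (X x)))) ∧
    -- fifth identity
    D.ell x (curvature nabla D.n Y D.n x) =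
        (1 - D.ell2 x * D.n2 x) *
          (lieOneForm D.n D.s Y x
            - D.P x (D.s x) (D.U x (Y x) + D.n2 x • D.F x (Y x))
            + 1 / 2 * D.P x (D.F x (Y x)) (diff D.n2 x + D.n2 x ^ 2 • diff D.ell2 x))
        + 1 / 2 * diff D.ell2 x (D.n x) *
          ((1 - D.ell2 x * D.n2 x) * diff D.n2 x (Y x) - D.ell2 x * D.n2 x ^ 2 * D.s x (Y x))
        - 1 / 2 * diff D.n2 x (D.n x) *
          ((1 - D.n2 x * D.ell2 x) * diff D.ell2 x (Y x) + D.ell2 x * D.s x (Y x)) := by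
  refine ⟨⟨D.connection, D.isMetricHypersurfaceConnection_connection⟩,
    fun nabla h X Y Z hX hY hZ x ↦ ⟨h.ell_curvature hX hY hZ x, h.ell_curvature_n_left hY hZ x,
      fun α hα ↦ h.curvature_n hX hY hα x, h.ell_curvature_n hX hY x, h.ell_curvature_n_n hY x⟩⟩
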